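/- Let $d\in\{2,3\}$, $\alpha\in(0,1]$, $\beta\in[0,d)$ and $R>0$. Let $n$ nodes have independent positions $x_1,\dots,x_n$, uniform in $[0,1]^d$, and let $X\in\mathbb R^{n\times d}$ be the matrix with rows $x_i$. Given the positions, let $G$ be the random graph on $\{1,\dots,n\}$ in which each pair $i\ne j$ with $z=\|x_i-x_j\|\le R$ is joined, independently of the other pairs, with probability $p(z)=\min\bigl(1,\alpha (z/R)^{-\beta}\bigr)$, and pairs at distance larger than $R$ are not joined. Let $L=I_n-\frac1n\mathbf 1\mathbf 1^{T}$, let $h_{ij}$ be the graph distance (number of hops) in $G$, and let $\widehat D_{ij}=(R\,h_{ij})^2$. The output of MDS-MAP is $\widehat X=U_d\Sigma_d^{1/2}\in\mathbb R^{n\times d}$, where $-\frac12L\widehat DL=U\Sigma V^{T}$ is a singular value decomposition with singular values in non-increasing order, $U_d$ consists of the first $d$ columns of $U$, and $\Sigma_d$ is the diagonal matrix of the $d$ largest singular values. Put $$R_{\mathrm{MDS}}=32\left(\frac{12\log n}{\alpha(n-2)}\right)^{1/d}$$ and let $\|\cdot\|_F$ be the Frobenius norm. Theorem. If $R>(1/\alpha)^{1/d}R_{\mathrm{MDS}}$,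 then with high probability $G$ is connected (so that $\widehat X$ is defined) and $$\min_{S\in\mathbb R^{d\times d}}\frac1{\sqrt n}\,\|LX-L\widehat XS\|_F\le\sqrt6\left(\frac{R_{\mathrm{MDS}}}{R}+20R\right)$$ for every output $\widehat X$ of MDS-MAP. Here "with high probability" means: for all $d\in\{2,3\}$, $\alpha\in(0,1]$ and $\varepsilon>0$ there is $N$ such that for all $n\ge N$, all $\beta\in[0,d)$ and all $R>(1/\alpha)^{1/d}R_{\mathrm{MDS}}$ the event has probability at least $1-\varepsilon$. -/

import Mathlib

noncomputable section

namespace MDSMap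

open MeasureTheory

/-- Euclidean distance between two points of `ℝ^d`. -/
def eucDist {d : ℕ} (x y : Fin d → ℝ) : ℝ :=
  dist (WithLp.toLp 2 x : EuclideanSpace ℝ (Fin d)) (WithLp.toLp 2 y)

/-- The detection probability `p(z) = min(1, α (z/R)^(-β))`. At `z = 0` with `β > 0`, where
`(z/R)^(-β) = ∞`, the value is `1`. -/
def detectProb (α β R z : ℝ) : ℝ :=
  if z = 0 ∧ 0 < β then 1 else min 1 (α * (z / R) ^ (-β))

/-- The sample space: positions of the `n` nodes, and one mark for each unordered pair of nodes. -/
abbrev Sample (n d : ℕ) : Type := (Fin n → Fin d → ℝ) × (Sym2 (Fin n) → ℝ)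

/-- The uniform probability measure on `[0,1]`. -/
def unif01 : Measure ℝ := volume.restrict (Set.Icc 0 1)

/-- The law of the model: the positions are independent and uniform in `[0,1]^d`; the marks are
independent, uniform in `[0,1]`, and independent of the positions. -/
def law (n d : ℕ) : Measure (Sample n d) :=
  (Measure.pi fun _ : Fin n => Measure.pi fun _ : Fin d => unif01).prod
    (Measure.pi fun _ : Sym2 (Fin n) => unif01)

/-- The position matrix `X`, whose `i`-th row is the position of node `i`. -/
def posMatrix {n d : ℕ} (ω : Sample n d) : Matrix (Fin n) (Fin d) ℝ := Matrix.of ω.1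

/-- The random geometric graph with detection failures. Given the positions, the pairs of distinct
nodes at distance `z ≤ R` are joined independently with probability `p(z)` (the uniform mark of the
pair is at most `p(z)`), and the pairs at distance more than `R` are not joined. -/
def graph {n d : ℕ} (α β R : ℝ) (ω : Sample n d) : SimpleGraph (Fin n) where
  Adj i j := i ≠ j ∧ eucDist (ω.1 i) (ω.1 j) ≤ R ∧
    ω.2 s(i, j) ≤ detectProb α β R (eucDist (ω.1 i) (ω.1 j))
  symm := ⟨by
    rintro i j ⟨h1, h2, h3⟩
    have hd : eucDist (ω.1 j) (ω.1 i) = eucDist (ω.1 i) (ω.1 j) := dist_comm _ _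
    exact ⟨h1.symm, hd ▸ h2, by rw [hd, Sym2.eq_swap]; exact h3⟩⟩
  loopless := ⟨fun _ h => h.1 rfl⟩

/-- The squared shortest path matrix `D̂` in the connectivity-based model: the shortest path length
is the minimum number of hops times the radio range. It is meaningful if `G` is connected. -/
def sqPathMatrix {n : ℕ} (R : ℝ) (G : SimpleGraph (Fin n)) : Matrix (Fin n) (Fin n) ℝ :=
  Matrix.of fun i j => (R * (G.dist i j : ℝ)) ^ 2

/-- The centering matrix `L = I - (1/n) 𝟙 𝟙ᵀ`. -/
def centering (n : ℕ) : Matrix (Fin n) (Fin n) ℝ :=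
  1 - (1 / (n : ℝ)) • Matrix.of fun _ _ => (1 : ℝ)

/-- `Y` is an output of classic metric MDS in dimension `d` on the squared distance matrix `M`:
`Y = U_d Σ_d^{1/2}`, for a singular value decomposition `U Σ Vᵀ` of `-(1/2) L M L` with
singular values in non-increasing order, where `U_d` consists of the first `d` columns of `U`.
(If `n < d`, the missing columns are zero.) Since singular value decompositions are not unique,
this is a relation. -/
def IsMDSOutput {n d : ℕ} (M : Matrix (Fin n) (Fin n) ℝ) (Y : Matrix (Fin n) (Fin d) ℝ) : Prop :=
  ∃ (U V : Matrix (Fin n) (Fin n) ℝ) (σ : Fin n → ℝ),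
    U ∈ Matrix.orthogonalGroup (Fin n) ℝ ∧ V ∈ Matrix.orthogonalGroup (Fin n) ℝ ∧
    (∀ k, 0 ≤ σ k) ∧ Antitone σ ∧
    (-(1 / 2) : ℝ) • (centering n * M * centering n) = U * Matrix.diagonal σ * V.transpose ∧
    Y = Matrix.of fun i (k : Fin d) =>
      if h : (k : ℕ) < n then U i ⟨k, h⟩ * Real.sqrt (σ ⟨k, h⟩) else 0

/-- `Y` is an output of MDS-MAP in dimension `d` on the connectivity graph `G` with radio
range `R`. -/
def IsMDSMapOutput {n d : ℕ} (R : ℝ) (G : SimpleGraph (Fin n))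
    (Y : Matrix (Fin n) (Fin d) ℝ) : Prop :=
  IsMDSOutput (sqPathMatrix R G) Y

/-- The Frobenius norm. -/
def frobNorm {m n : ℕ} (A : Matrix (Fin m) (Fin n) ℝ) : ℝ :=
  Real.sqrt (∑ i, ∑ j, A i j ^ 2)

/-- `R_MDS = 32 (12 log n / (α (n - 2)))^(1/d)`. -/
def RMDS (d n : ℕ) (α : ℝ) : ℝ :=
  32 * (12 * Real.log n / (α * ((n : ℝ) - 2))) ^ (1 / (d : ℝ))

end MDSMap

end

noncomputable section

namespace MDSMap

open MeasureTheory Matrix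

section LinearAlgebra

theorem frobNorm_eq_sqrt_trace {m n : ℕ} (A : Matrix (Fin m) (Fin n) ℝ) :
    frobNorm A = Real.sqrt (trace (Aᵀ * A)) := by
  unfold frobNorm
  congr 1
  rw [Finset.sum_comm]
  simp [trace, Matrix.mul_apply, sq]

theorem frobNorm_nonneg {m n : ℕ} (A : Matrix (Fin m) (Fin n) ℝ) : 0 ≤ frobNorm A :=
  Real.sqrt_nonneg _

theorem frobNorm_sq {m n : ℕ} (A : Matrix (Fin m) (Fin n) ℝ) :
    frobNorm A ^ 2 = trace (Aᵀ * A) := by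
  rw [frobNorm_eq_sqrt_trace, Real.sq_sqrt]
  rw [trace]
  refine Finset.sum_nonneg fun i _ => ?_
  simp only [diag_apply, Matrix.mul_apply, transpose_apply]
  exact Finset.sum_nonneg fun j _ => mul_self_nonneg _

theorem frobNorm_sq_eq_sum {m n : ℕ} (A : Matrix (Fin m) (Fin n) ℝ) :
    frobNorm A ^ 2 = ∑ i, ∑ j, A i j ^ 2 :=
  Real.sq_sqrt (Finset.sum_nonneg fun _ _ => Finset.sum_nonneg fun _ _ => sq_nonneg _)

theorem frobNorm_add_le {m n : ℕ} (A B : Matrix (Fin m) (Fin n) ℝ) :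
    frobNorm (A + B) ≤ frobNorm A + frobNorm B := by
  let _ := Matrix.frobeniusNormedAddCommGroup (m := Fin m) (n := Fin n) (α := ℝ)
  have h (C : Matrix (Fin m) (Fin n) ℝ) : frobNorm C = ‖C‖ := by
    rw [Matrix.frobenius_norm_def, frobNorm, Real.sqrt_eq_rpow]
    simp
  rw [h, h, h]
  exact norm_add_le A B

theorem frobNorm_smul {m n : ℕ} (c : ℝ) (A : Matrix (Fin m) (Fin n) ℝ) :
    frobNorm (c • A) = |c| * frobNorm A := by
  rw [frobNorm, frobNorm, ← Real.sqrt_sq_eq_abs, ← Real.sqrt_mul (sq_nonneg c)]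
  simp [Finset.mul_sum, mul_pow]

theorem frobNorm_transpose {m n : ℕ} (A : Matrix (Fin m) (Fin n) ℝ) :
    frobNorm Aᵀ = frobNorm A := by
  rw [frobNorm, frobNorm, Finset.sum_comm]
  rfl

/-- Orthogonal projections do not increase the Frobenius norm. -/
theorem frobNorm_proj_mul_le {m n : ℕ} {P : Matrix (Fin m) (Fin m) ℝ} (hs : Pᵀ = P)
    (hi : P * P = P) (A : Matrix (Fin m) (Fin n) ℝ) : frobNorm (P * A) ≤ frobNorm A := by
  refine (sq_le_sq₀ (frobNorm_nonneg _) (frobNorm_nonneg _)).1 ?_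
  have h1 : frobNorm (P * A) ^ 2 = trace (Aᵀ * (P * A)) := by
    rw [frobNorm_sq, transpose_mul, hs, Matrix.mul_assoc, ← Matrix.mul_assoc P P A, hi]
  have h2 : frobNorm ((1 - P) * A) ^ 2 = trace (Aᵀ * A) - trace (Aᵀ * (P * A)) := by
    have : (1 - P) * (1 - P) = 1 - P :=
      IsIdempotentElem.one_sub (a := P) hi
    rw [frobNorm_sq, transpose_mul, transpose_sub, hs, transpose_one, Matrix.mul_assoc,
      ← Matrix.mul_assoc (1 - P) (1 - P) A, this, Matrix.sub_mul, Matrix.mul_sub, trace_sub,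
      Matrix.one_mul]
  have h3 := frobNorm_sq A
  nlinarith [sq_nonneg (frobNorm ((1 - P) * A))]

theorem frobNorm_mul_proj_le {m n : ℕ} {P : Matrix (Fin n) (Fin n) ℝ} (hs : Pᵀ = P)
    (hi : P * P = P) (A : Matrix (Fin m) (Fin n) ℝ) : frobNorm (A * P) ≤ frobNorm A := by
  rw [← frobNorm_transpose, ← frobNorm_transpose A, transpose_mul, hs]
  exact frobNorm_proj_mul_le hs hi _

theorem sum_tail_le_weighted_sum {n d : ℕ} (hdn : d ≤ n) (σ w : Fin n → ℝ)
    (hσ : ∀ k, 0 ≤ σ k) (hanti : Antitone σ) (hw0 : ∀ k, 0 ≤ w k) (hw1 : ∀ k, w k ≤ 1)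
    (hw : ∑ k, w k = d) :
    ∑ k : Fin n, (if (k : ℕ) < d then 0 else σ k ^ 2) ≤ ∑ k, σ k ^ 2 * (1 - w k) := by
  obtain ⟨c, hc1, hc2⟩ : ∃ c : ℝ, (∀ k : Fin n, (k : ℕ) < d → c ≤ σ k ^ 2) ∧
      ∀ k : Fin n, d ≤ (k : ℕ) → σ k ^ 2 ≤ c := by
    rcases hdn.lt_or_eq with h | h
    · refine ⟨σ ⟨d, h⟩ ^ 2, fun k hk => ?_, fun k hk => ?_⟩
      · exact pow_le_pow_left₀ (hσ _) (hanti (Fin.le_def.2 hk.le)) 2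
      · exact pow_le_pow_left₀ (hσ _) (hanti (Fin.le_def.2 hk)) 2
    · exact ⟨0, fun k _ => sq_nonneg _, fun k hk => absurd k.2 (by omega)⟩
  have hcard : ∑ k : Fin n, (if (k : ℕ) < d then (1 : ℝ) else 0) = d := by
    have : (Finset.univ.filter fun k : Fin n => (k : ℕ) < d).card = d := by
      simp [Fin.card_filter_val_lt, hdn]
    rw [← Finset.sum_filter]
    simp [this]
  have h0 : ∑ k : Fin n, c * ((if (k : ℕ) < d then (1 : ℝ) else 0) - w k) = 0 := by
    rw [← Finset.mul_sum, Finset.sum_sub_distrib, hcard, hw]; simp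
  rw [← sub_nonneg, ← Finset.sum_sub_distrib, ← h0]
  refine Finset.sum_le_sum fun k _ => ?_
  split_ifs with hk
  · nlinarith [hc1 k hk, hw1 k]
  · nlinarith [hc2 k (not_lt.1 hk), hw0 k]

theorem diag_conj_proj_nonneg {n : ℕ} {P : Matrix (Fin n) (Fin n) ℝ} (hs : Pᵀ = P)
    (hi : P * P = P) (U : Matrix (Fin n) (Fin n) ℝ) (k : Fin n) : 0 ≤ (Uᵀ * P * U) k k := by
  have : Uᵀ * P * U = (P * U)ᵀ * (P * U) := by
    rw [transpose_mul, hs, ← Matrix.mul_assoc, Matrix.mul_assoc Uᵀ P P, hi]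
  rw [this, Matrix.mul_apply]
  exact Finset.sum_nonneg fun j _ => mul_self_nonneg _

theorem frobNorm_sq_mul_diagonal_mul {n : ℕ} (P U V : Matrix (Fin n) (Fin n) ℝ)
    (hs : Pᵀ = P) (hi : P * P = P) (hV : Vᵀ * V = 1) (σ : Fin n → ℝ) :
    frobNorm (P * (U * diagonal σ * Vᵀ)) ^ 2 = ∑ k, σ k ^ 2 * (Uᵀ * P * U) k k := by
  have h : (P * (U * diagonal σ * Vᵀ))ᵀ * (P * (U * diagonal σ * Vᵀ)) =
      V * (diagonal σ * (Uᵀ * P * U) * diagonal σ * Vᵀ) := by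
    simp only [transpose_mul, transpose_transpose, diagonal_transpose, hs, Matrix.mul_assoc]
    rw [← Matrix.mul_assoc P P, hi]
  rw [frobNorm_sq, h, trace_mul_comm, Matrix.mul_assoc, hV, Matrix.mul_one]
  refine Finset.sum_congr rfl fun k _ => ?_
  simp only [diag_apply, Matrix.mul_diagonal, Matrix.diagonal_mul]
  ring

/-- The part of a matrix outside of its `d` leading left singular vectors is, in the Frobenius
norm, at most the distance to any matrix of the form `A Aᵀ` with `A` of full rank `d`. -/
theorem frobNorm_tail_le {n d : ℕ} (hdn : d ≤ n) (A : Matrix (Fin n) (Fin d) ℝ)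
    (hA : IsUnit (Aᵀ * A).det) (U V : Matrix (Fin n) (Fin n) ℝ) (σ : Fin n → ℝ)
    (hU : U * Uᵀ = 1) (hV : Vᵀ * V = 1) (hσ : ∀ k, 0 ≤ σ k)
    (hanti : Antitone σ) :
    ∑ k : Fin n, (if (k : ℕ) < d then 0 else σ k ^ 2) ≤
      frobNorm (U * diagonal σ * Vᵀ - A * Aᵀ) ^ 2 := by
  set Γ : Matrix (Fin d) (Fin d) ℝ := (Aᵀ * A)⁻¹ with hΓ
  have hΓs : Γᵀ = Γ := by
    rw [hΓ, transpose_nonsing_inv, transpose_mul, transpose_transpose]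
  have hU' : Uᵀ * U = 1 := mul_eq_one_comm.1 hU
  set P : Matrix (Fin n) (Fin n) ℝ := A * Γ * Aᵀ with hP
  have hPs : Pᵀ = P := by
    simp only [hP, transpose_mul, transpose_transpose, hΓs, Matrix.mul_assoc]
  have hPA : P * A = A := by
    rw [hP, Matrix.mul_assoc, Matrix.mul_assoc, hΓ, Matrix.nonsing_inv_mul _ hA, Matrix.mul_one]
  have hPi : P * P = P := by
    conv_lhs => rw [hP]
    rw [hP, ← Matrix.mul_assoc, ← Matrix.mul_assoc, ← hP, hPA]
  have hPt : trace P = d := by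
    rw [hP, trace_mul_comm, ← Matrix.mul_assoc, hΓ, Matrix.mul_nonsing_inv _ hA]
    simp
  have hQs : (1 - P)ᵀ = 1 - P := by rw [transpose_sub, hPs, transpose_one]
  have hQi : (1 - P) * (1 - P) = 1 - P := IsIdempotentElem.one_sub (a := P) hPi
  have hQ (k : Fin n) : (Uᵀ * (1 - P) * U) k k = 1 - (Uᵀ * P * U) k k := by
    rw [Matrix.mul_sub, Matrix.sub_mul, Matrix.mul_one, hU', Matrix.sub_apply, Matrix.one_apply_eq]
  have h1 : frobNorm ((1 - P) * (U * diagonal σ * Vᵀ)) ^ 2 ≤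
      frobNorm (U * diagonal σ * Vᵀ - A * Aᵀ) ^ 2 := by
    have : (1 - P) * (U * diagonal σ * Vᵀ) = (1 - P) * (U * diagonal σ * Vᵀ - A * Aᵀ) := by
      rw [Matrix.mul_sub (1 - P), ← Matrix.mul_assoc (1 - P) A, Matrix.sub_mul 1 P A, hPA]
      simp
    rw [this]
    exact pow_le_pow_left₀ (frobNorm_nonneg _) (frobNorm_proj_mul_le hQs hQi _) 2
  refine le_trans ?_ h1
  rw [frobNorm_sq_mul_diagonal_mul _ _ _ hQs hQi hV]
  simp only [hQ]
  refine sum_tail_le_weighted_sum hdn σ _ hσ hanti (diag_conj_proj_nonneg hPs hPi U)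
    (fun k => ?_) ?_
  · have := diag_conj_proj_nonneg hQs hQi U k
    rw [hQ] at this
    linarith
  · change trace (Uᵀ * P * U) = d
    rw [trace_mul_comm, ← Matrix.mul_assoc, hU, Matrix.one_mul, hPt]

theorem isUnit_det_gram {n d : ℕ} (A : Matrix (Fin n) (Fin d) ℝ) {l : ℝ} (hl : 0 < l)
    (hA : ∀ b : Fin d → ℝ, l * ∑ k, b k ^ 2 ≤ ∑ i, (A *ᵥ b) i ^ 2) :
    IsUnit (Aᵀ * A).det := by
  rw [isUnit_iff_ne_zero]
  intro h
  obtain ⟨b, hb, hAb⟩ := Matrix.exists_mulVec_eq_zero_iff.2 h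
  have h1 : ∑ i, (A *ᵥ b) i ^ 2 = 0 := by
    have : b ⬝ᵥ ((Aᵀ * A) *ᵥ b) = ∑ i, (A *ᵥ b) i ^ 2 := by
      rw [← Matrix.mulVec_mulVec, Matrix.dotProduct_mulVec, Matrix.vecMul_transpose]
      simp [dotProduct, sq]
    rw [← this, hAb, dotProduct_zero]
  have h2 := hA b
  rw [h1] at h2
  have h3 : ∑ k, b k ^ 2 = 0 := by
    refine le_antisymm ?_ (Finset.sum_nonneg fun _ _ => sq_nonneg _)
    nlinarith
  rw [Finset.sum_eq_zero_iff_of_nonneg fun _ _ => sq_nonneg _] at h3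
  exact hb (funext fun k => by simpa using h3 k (Finset.mem_univ k))

theorem mul_frobNorm_sq_le {m n d : ℕ} (A : Matrix (Fin n) (Fin d) ℝ) {l : ℝ}
    (hA : ∀ b : Fin d → ℝ, l * ∑ k, b k ^ 2 ≤ ∑ i, (A *ᵥ b) i ^ 2)
    (B : Matrix (Fin m) (Fin d) ℝ) :
    l * frobNorm B ^ 2 ≤ frobNorm (B * Aᵀ) ^ 2 := by
  rw [frobNorm_sq_eq_sum, frobNorm_sq_eq_sum, Finset.mul_sum]
  refine Finset.sum_le_sum fun i _ => (hA (B i)).trans (le_of_eq ?_)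
  refine Finset.sum_congr rfl fun j _ => ?_
  simp [Matrix.mulVec, dotProduct, Matrix.mul_apply, mul_comm]

/-- The projection away from the `d` leading left singular vectors of a perturbation of `A Aᵀ`
nearly annihilates `A`. -/
theorem frobNorm_proj_le {n d : ℕ} (hdn : d ≤ n) (A : Matrix (Fin n) (Fin d) ℝ)
    {l : ℝ} (hl : 0 < l)
    (hA : ∀ b : Fin d → ℝ, l * ∑ k, b k ^ 2 ≤ ∑ i, (A *ᵥ b) i ^ 2)
    (U V : Matrix (Fin n) (Fin n) ℝ) (σ χ : Fin n → ℝ)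
    (hU : U * Uᵀ = 1) (hV : Vᵀ * V = 1) (hσ : ∀ k, 0 ≤ σ k) (hanti : Antitone σ)
    (hχ : ∀ k : Fin n, χ k = if (k : ℕ) < d ∧ σ k ≠ 0 then 0 else 1) :
    l * frobNorm (U * diagonal χ * Uᵀ * A) ^ 2 ≤
      (2 * frobNorm (U * diagonal σ * Vᵀ - A * Aᵀ)) ^ 2 := by
  have hU' : Uᵀ * U = 1 := mul_eq_one_comm.1 hU
  set Q := U * diagonal χ * Uᵀ with hQ
  have hχ2 (k) : χ k * χ k = χ k := by rw [hχ]; split_ifs <;> simp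
  have hQs : Qᵀ = Q := by
    simp only [hQ, transpose_mul, transpose_transpose, diagonal_transpose, Matrix.mul_assoc]
  have hQU : Q * U = U * diagonal χ := by rw [hQ, Matrix.mul_assoc, hU', Matrix.mul_one]
  have hQi : Q * Q = Q := by
    conv_lhs => rw [hQ]
    rw [← hQ]
    conv_lhs => rw [hQ, ← Matrix.mul_assoc, ← Matrix.mul_assoc, ← hQ, hQU, Matrix.mul_assoc U,
      diagonal_mul_diagonal]
    simp only [hχ2]
    exact hQ.symm
  refine (mul_frobNorm_sq_le A hA _).trans ?_
  refine pow_le_pow_left₀ (frobNorm_nonneg _) ?_ 2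
  set E := U * diagonal σ * Vᵀ - A * Aᵀ with hE
  have h1 : frobNorm (Q * (U * diagonal σ * Vᵀ)) ≤ frobNorm E := by
    refine (sq_le_sq₀ (frobNorm_nonneg _) (frobNorm_nonneg _)).1 ?_
    refine le_trans (le_of_eq ?_)
      (frobNorm_tail_le hdn A (isUnit_det_gram A hl hA) U V σ hU hV hσ hanti)
    rw [frobNorm_sq_mul_diagonal_mul _ _ _ hQs hQi hV]
    refine Finset.sum_congr rfl fun k _ => ?_
    rw [Matrix.mul_assoc, hQU, ← Matrix.mul_assoc, hU', Matrix.one_mul, diagonal_apply_eq, hχ]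
    by_cases hk : (k : ℕ) < d <;> by_cases hk' : σ k = 0 <;> simp [hk, hk']
  have h2 : frobNorm (-(1 : ℝ) • (Q * E)) ≤ frobNorm E := by
    rw [frobNorm_smul]
    simpa using frobNorm_proj_mul_le hQs hQi E
  have h3 : Q * A * Aᵀ = Q * (U * diagonal σ * Vᵀ) + -(1 : ℝ) • (Q * E) := by
    rw [hE, Matrix.mul_sub Q, Matrix.mul_assoc Q A]
    simp
  rw [h3]
  linarith [frobNorm_add_le (Q * (U * diagonal σ * Vᵀ)) (-(1 : ℝ) • (Q * E))]

theorem centering_transpose (n : ℕ) : (centering n)ᵀ = centering n := by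
  ext i j
  simp [centering, Matrix.one_apply, eq_comm]

theorem centering_mul_apply {n m : ℕ} (A : Matrix (Fin n) (Fin m) ℝ) (i : Fin n) (k : Fin m) :
    (centering n * A) i k = A i k - (1 / n : ℝ) * ∑ j, A j k := by
  rw [centering, Matrix.sub_mul, Matrix.one_mul, Matrix.sub_apply, Matrix.smul_mul,
    Matrix.smul_apply, Matrix.mul_apply]
  simp

theorem centering_mul_self {n : ℕ} (hn : n ≠ 0) : centering n * centering n = centering n := by
  have hn' : (n : ℝ) ≠ 0 := by exact_mod_cast hn
  ext i k
  rw [centering_mul_apply]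
  simp only [centering, Matrix.sub_apply, Matrix.smul_apply, Matrix.of_apply, smul_eq_mul,
    Finset.sum_sub_distrib, Matrix.one_apply]
  simp [hn']

/-- If the configuration is nondegenerate and the squared distances are known approximately, then
every output of classic MDS is close to the configuration up to a linear map. -/
theorem exists_frobNorm_le_of_isMDSOutput {n d : ℕ} (hdn : d ≤ n) (hn : n ≠ 0)
    (A : Matrix (Fin n) (Fin d) ℝ) {l : ℝ} (hl : 0 < l)
    (hA : ∀ b : Fin d → ℝ, l * ∑ k, b k ^ 2 ≤ ∑ i, (A *ᵥ b) i ^ 2)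
    (M : Matrix (Fin n) (Fin n) ℝ)
    (Y : Matrix (Fin n) (Fin d) ℝ) (hY : IsMDSOutput M Y) :
    ∃ S : Matrix (Fin d) (Fin d) ℝ, l * frobNorm (A - centering n * Y * S) ^ 2 ≤
      (2 * frobNorm ((-(1 / 2) : ℝ) • (centering n * M * centering n) - A * Aᵀ)) ^ 2 := by
  obtain ⟨U, V, σ, hU, hV, hσ, hanti, hM, rfl⟩ := hY
  have hU1 : U * Uᵀ = 1 := (mem_orthogonalGroup_iff (Fin n) ℝ).1 hU
  have hV1 : Vᵀ * V = 1 := (mem_orthogonalGroup_iff' (Fin n) ℝ).1 hV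
  have hLU : centering n * (U * diagonal σ) = U * diagonal σ := by
    have h := congrArg (fun Z => centering n * Z * V) hM
    have h' := congrArg (fun Z => Z * V) hM
    simp only [Matrix.mul_assoc, Matrix.mul_smul, Matrix.smul_mul, hV1, Matrix.mul_one] at h h'
    rw [← Matrix.mul_assoc, centering_mul_self hn, h'] at h
    exact h.symm
  set χ : Fin n → ℝ := fun k => if (k : ℕ) < d ∧ σ k ≠ 0 then 0 else 1 with hχ
  let S : Matrix (Fin d) (Fin d) ℝ := Matrix.of fun k j =>
    (Real.sqrt (σ (Fin.castLE hdn k)))⁻¹ * (Uᵀ * A) (Fin.castLE hdn k) j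
  refine ⟨S, ?_⟩
  have hYS : (Matrix.of fun i (k : Fin d) =>
      if h : (k : ℕ) < n then U i ⟨k, h⟩ * Real.sqrt (σ ⟨k, h⟩) else 0) * S =
      U * diagonal (fun k => 1 - χ k) * Uᵀ * A := by
    ext i j
    rw [Matrix.mul_assoc (U * _), Matrix.mul_apply, Matrix.mul_apply]
    simp only [Matrix.mul_diagonal, Matrix.of_apply]
    set g : ℕ → ℝ := fun k => if h : k < n then
      (if k < d then U i ⟨k, h⟩ * (1 - χ ⟨k, h⟩) * (Uᵀ * A) ⟨k, h⟩ j else 0) else 0 with hg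
    have e1 : ∀ k : Fin n, U i k * (1 - χ k) * (Uᵀ * A) k j = g k := by
      intro k
      simp only [hg, k.2, dif_pos]
      by_cases hk : (k : ℕ) < d <;> simp [hk, hχ]
    rw [Finset.sum_congr rfl fun k _ => e1 k, Fin.sum_univ_eq_sum_range g n]
    have e2 : ∀ k : Fin d, (if h : (k : ℕ) < n then U i ⟨k, h⟩ * Real.sqrt (σ ⟨k, h⟩) else 0) *
        S k j = g k := by
      intro k
      have hk : (k : ℕ) < n := k.2.trans_le hdn
      have hk2 : Fin.castLE hdn k = ⟨k, hk⟩ := rfl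
      simp only [hg, hk, dif_pos, k.2, if_pos, S, Matrix.of_apply, hk2, hχ, true_and]
      by_cases h0 : σ ⟨k, hk⟩ = 0
      · simp [h0]
      · have : Real.sqrt (σ ⟨k, hk⟩) ≠ 0 := by
          rw [Real.sqrt_ne_zero (hσ _)]; exact h0
        simp only [h0, ne_eq, not_false_eq_true, if_true]
        field_simp
        simp
    rw [Finset.sum_congr rfl fun k _ => e2 k, Fin.sum_univ_eq_sum_range g d]
    refine Finset.sum_subset (Finset.range_subset_range.2 hdn) fun k _ hk => ?_
    simp only [Finset.mem_range] at hk
    simp [hg, hk]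
  have hL : centering n * (U * diagonal (fun k => 1 - χ k)) = U * diagonal (fun k => 1 - χ k) := by
    have : U * diagonal (fun k => 1 - χ k) =
        (U * diagonal σ) * diagonal (fun k => (1 - χ k) * (σ k)⁻¹) := by
      rw [Matrix.mul_assoc, diagonal_mul_diagonal]
      congr 2
      ext k
      by_cases h0 : σ k = 0
      · simp [h0, hχ]
      · field_simp
    rw [this, ← Matrix.mul_assoc, hLU]
  have key : A - centering n * (Matrix.of fun i (k : Fin d) =>
      if h : (k : ℕ) < n then U i ⟨k, h⟩ * Real.sqrt (σ ⟨k, h⟩) else 0) * S =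
      U * diagonal χ * Uᵀ * A := by
    rw [Matrix.mul_assoc, hYS, ← Matrix.mul_assoc, ← Matrix.mul_assoc, hL]
    have : (diagonal fun k => 1 - χ k : Matrix (Fin n) (Fin n) ℝ) = 1 - diagonal χ := by
      rw [← diagonal_one, diagonal_sub]
    rw [this, Matrix.mul_sub, Matrix.mul_one, Matrix.sub_mul, hU1, Matrix.sub_mul, Matrix.one_mul]
    simp
  rw [key, hM]
  exact frobNorm_proj_le hdn A hl hA U V σ χ hU1 hV1 hσ hanti fun k => rfl

end LinearAlgebra

section Configuration

theorem eucDist_sq {d : ℕ} (x y : Fin d → ℝ) : eucDist x y ^ 2 = ∑ k, (x k - y k) ^ 2 := by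
  rw [eucDist, EuclideanSpace.dist_eq, Real.sq_sqrt (Finset.sum_nonneg fun _ _ => sq_nonneg _)]
  simp [Real.dist_eq, sq_abs]

theorem eucDist_nonneg {d : ℕ} (x y : Fin d → ℝ) : 0 ≤ eucDist x y := dist_nonneg

theorem eucDist_triangle {d : ℕ} (x y z : Fin d → ℝ) :
    eucDist x z ≤ eucDist x y + eucDist y z := dist_triangle _ _ _

theorem eucDist_comm {d : ℕ} (x y : Fin d → ℝ) : eucDist x y = eucDist y x := dist_comm _ _

theorem sq_frobNorm_le_of_entries {n : ℕ} (A : Matrix (Fin n) (Fin n) ℝ) {B : ℝ}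
    (h : ∀ i j, |A i j| ≤ B) : frobNorm A ^ 2 ≤ (n * B) ^ 2 := by
  rw [frobNorm_sq_eq_sum]
  calc ∑ i, ∑ j, A i j ^ 2 ≤ ∑ _i : Fin n, ∑ _j : Fin n, B ^ 2 :=
        Finset.sum_le_sum fun i _ => Finset.sum_le_sum fun j _ =>
          sq_le_sq' (abs_le.1 (h i j)).1 (abs_le.1 (h i j)).2
    _ = (n * B) ^ 2 := by simp; ring

theorem centering_mul_const {n : ℕ} (hn : n ≠ 0) (f : Fin n → ℝ) :
    centering n * Matrix.of (fun _ j => f j) = 0 := by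
  have hn' : (n : ℝ) ≠ 0 := by exact_mod_cast hn
  ext i j
  rw [centering_mul_apply]
  simp [hn']

theorem const_mul_centering {n : ℕ} (hn : n ≠ 0) (f : Fin n → ℝ) :
    Matrix.of (fun i _ => f i) * centering n = 0 := by
  have h := congrArg transpose (centering_mul_const hn f)
  rw [transpose_mul, centering_transpose, transpose_zero] at h
  exact h

/-- Double centering turns squared distances into the Gram matrix of the centered points. -/
theorem gram_eq_double_centering {n d : ℕ} (hn : n ≠ 0) (x : Fin n → Fin d → ℝ) :
    (centering n * Matrix.of x) * (centering n * Matrix.of x)ᵀ =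
      (-(1 / 2) : ℝ) • (centering n * (Matrix.of fun i j => eucDist (x i) (x j) ^ 2)
        * centering n) := by
  have h : (Matrix.of fun i j => eucDist (x i) (x j) ^ 2 : Matrix (Fin n) (Fin n) ℝ) =
      Matrix.of (fun i _ => ∑ k, x i k ^ 2) + Matrix.of (fun _ j => ∑ k, x j k ^ 2) -
        (2 : ℝ) • (Matrix.of x * (Matrix.of x)ᵀ) := by
    ext i j
    simp only [Matrix.of_apply, eucDist_sq, Matrix.sub_apply, Matrix.add_apply, Matrix.smul_apply,
      Matrix.mul_apply, transpose_apply, smul_eq_mul, Finset.mul_sum, ← Finset.sum_add_distrib,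
      ← Finset.sum_sub_distrib]
    exact Finset.sum_congr rfl fun k _ => by ring
  rw [h, Matrix.mul_sub, Matrix.mul_add, centering_mul_const hn, Matrix.sub_mul, Matrix.add_mul,
    Matrix.mul_assoc _ _ (centering n), const_mul_centering hn, transpose_mul, centering_transpose]
  simp [Matrix.mul_assoc, smul_smul]

theorem exists_frobNorm_le_of_sq_dist_error {n d : ℕ} (hn : n ≠ 0) (hdn : d ≤ n)
    (x : Fin n → Fin d → ℝ) (M : Matrix (Fin n) (Fin n) ℝ) {B : ℝ} (hB : 0 ≤ B)
    (hM : ∀ i j, |M i j - eucDist (x i) (x j) ^ 2| ≤ B)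
    (hx : ∀ b : Fin d → ℝ, (n / 16 : ℝ) * ∑ k, b k ^ 2 ≤
      ∑ i, ((centering n * Matrix.of x) *ᵥ b) i ^ 2)
    (Y : Matrix (Fin n) (Fin d) ℝ) (hY : IsMDSOutput M Y) :
    ∃ S : Matrix (Fin d) (Fin d) ℝ,
      1 / Real.sqrt n * frobNorm (centering n * Matrix.of x - centering n * Y * S) ≤ 4 * B := by
  have hn' : (0 : ℝ) < n := by exact_mod_cast Nat.pos_of_ne_zero hn
  obtain ⟨S, hS⟩ := exists_frobNorm_le_of_isMDSOutput hdn hn _ (by positivity) hx M Y hY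
  refine ⟨S, ?_⟩
  set f := frobNorm (centering n * Matrix.of x - centering n * Y * S)
  set D : Matrix (Fin n) (Fin n) ℝ := Matrix.of fun i j => eucDist (x i) (x j) ^ 2 with hD
  have h1 : (-(1 / 2) : ℝ) • (centering n * M * centering n) -
      (centering n * Matrix.of x) * (centering n * Matrix.of x)ᵀ =
      (-(1 / 2) : ℝ) • (centering n * (M - D) * centering n) := by
    rw [gram_eq_double_centering hn, Matrix.mul_sub, Matrix.sub_mul, smul_sub]
  rw [h1, frobNorm_smul] at hS
  have h2 : frobNorm (centering n * (M - D) * centering n) ≤ frobNorm (M - D) :=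
    (frobNorm_mul_proj_le (centering_transpose n) (centering_mul_self hn) _).trans
      (frobNorm_proj_mul_le (centering_transpose n) (centering_mul_self hn) _)
  have h3 : frobNorm (M - D) ^ 2 ≤ (n * B) ^ 2 :=
    sq_frobNorm_le_of_entries _ fun i j => hM i j
  have h4 : frobNorm (centering n * (M - D) * centering n) ^ 2 ≤ (n * B) ^ 2 :=
    (pow_le_pow_left₀ (frobNorm_nonneg _) h2 2).trans h3
  have h5 : f ^ 2 ≤ n * (4 * B) ^ 2 := by
    have e : |(-(1 / 2) : ℝ)| = 1 / 2 := by norm_num [abs_of_neg]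
    rw [e] at hS
    have : (n : ℝ) * f ^ 2 ≤ n * (n * (4 * B) ^ 2) := by nlinarith
    exact le_of_mul_le_mul_left this hn'
  rw [one_div, inv_mul_le_iff₀ (Real.sqrt_pos.2 hn')]
  refine le_trans (Real.le_sqrt_of_sq_le h5) (le_of_eq ?_)
  rw [Real.sqrt_mul hn'.le, Real.sqrt_sq (by positivity)]

/-- The trivial bound for points of the unit cube. -/
theorem frobNorm_centering_mul_le {n d : ℕ} (hn : n ≠ 0) (x : Fin n → Fin d → ℝ)
    (hx : ∀ i k, x i k ∈ Set.Icc (0 : ℝ) 1) :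
    1 / Real.sqrt n * frobNorm (centering n * Matrix.of x) ≤ Real.sqrt d := by
  have hn' : (0 : ℝ) < n := by exact_mod_cast Nat.pos_of_ne_zero hn
  rw [one_div, inv_mul_le_iff₀ (Real.sqrt_pos.2 hn'), ← Real.sqrt_mul hn'.le]
  refine (frobNorm_proj_mul_le (centering_transpose n) (centering_mul_self hn) _).trans ?_
  refine Real.sqrt_le_sqrt ?_
  calc ∑ i, ∑ j, x i j ^ 2 ≤ ∑ _i : Fin n, ∑ _j : Fin d, (1 : ℝ) :=
        Finset.sum_le_sum fun i _ => Finset.sum_le_sum fun j _ =>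
          pow_le_one₀ (hx i j).1 (hx i j).2
    _ = n * d := by simp

/-- Near-isotropic empirical second moments and a small empirical mean make the centered
configuration nondegenerate. -/
theorem centering_quadratic_form_ge {n d : ℕ} (hn : n ≠ 0) (hd : d ≤ 3) (x : Fin n → Fin d → ℝ)
    (h1 : ∀ k, |∑ i, (x i k - 1 / 2)| ≤ n * (1 / 200))
    (h2 : ∀ k l, |∑ i, ((x i k - 1 / 2) * (x i l - 1 / 2) - if k = l then 1 / 12 else 0)| ≤
      n * (1 / 200)) (b : Fin d → ℝ) :
    (n / 16 : ℝ) * ∑ k, b k ^ 2 ≤ ∑ i, ((centering n * Matrix.of x) *ᵥ b) i ^ 2 := by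
  have hn' : (0 : ℝ) < n := by exact_mod_cast Nat.pos_of_ne_zero hn
  set m : Fin d → ℝ := fun k => ∑ i, (x i k - 1 / 2) with hm
  set y : Fin n → ℝ := fun i => ∑ k, (x i k - 1 / 2) * b k with hy
  have e1 : ∀ i, ((centering n * Matrix.of x) *ᵥ b) i = y i - 1 / n * ∑ j, y j := by
    intro i
    have : ∑ j, y j = ∑ k, m k * b k := by
      rw [hy, Finset.sum_comm]
      simp only [hm, Finset.sum_mul]
    rw [this]
    simp only [Matrix.mulVec, dotProduct, hy, centering_mul_apply, Finset.mul_sum, Matrix.of_apply,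
      ← Finset.sum_sub_distrib]
    refine Finset.sum_congr rfl fun k _ => ?_
    have : ∑ j, x j k = m k + n * (1 / 2) := by
      simp [hm, Finset.sum_sub_distrib]
    rw [← Finset.mul_sum, this]
    field_simp
    ring
  have e2 : ∑ i, ((centering n * Matrix.of x) *ᵥ b) i ^ 2 =
      ∑ i, y i ^ 2 - 1 / n * (∑ j, y j) ^ 2 := by
    simp only [e1, sub_sq, Finset.sum_add_distrib, Finset.sum_sub_distrib, ← Finset.sum_mul,
      ← Finset.mul_sum]
    simp
    field_simp
    ring
  set a : ℝ := ∑ k, |b k| with ha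
  have ha0 : 0 ≤ a := Finset.sum_nonneg fun _ _ => abs_nonneg _
  have ha2 : a ^ 2 ≤ 3 * ∑ k, b k ^ 2 := by
    have h := sq_sum_le_card_mul_sum_sq (s := (Finset.univ : Finset (Fin d))) (f := fun k => |b k|)
    simp only [sq_abs, Finset.card_univ, Fintype.card_fin] at h
    refine h.trans (mul_le_mul_of_nonneg_right (by exact_mod_cast hd)
      (Finset.sum_nonneg fun _ _ => sq_nonneg _))
  have e3 : |∑ j, y j| ≤ n * (1 / 200) * a := by
    have : ∑ j, y j = ∑ k, m k * b k := by
      rw [hy, Finset.sum_comm]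
      simp only [hm, Finset.sum_mul]
    rw [this, ha, Finset.mul_sum]
    refine (Finset.abs_sum_le_sum_abs _ _).trans (Finset.sum_le_sum fun k _ => ?_)
    rw [abs_mul]
    exact mul_le_mul_of_nonneg_right (h1 k) (abs_nonneg _)
  have e4 : |∑ i, y i ^ 2 - n * (1 / 12) * ∑ k, b k ^ 2| ≤ n * (1 / 200) * a ^ 2 := by
    have : ∑ i, y i ^ 2 - n * (1 / 12) * ∑ k, b k ^ 2 = ∑ k : Fin d, ∑ l : Fin d,
        (∑ i : Fin n, ((x i k - 1 / 2) * (x i l - 1 / 2) - if k = l then 1 / 12 else 0)) *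
          (b k * b l) := by
      have e5 : ∀ i, y i ^ 2 = ∑ k : Fin d, ∑ l : Fin d, (x i k - 1 / 2) * (x i l - 1 / 2) * (b k * b l) := by
        intro i
        rw [sq, hy, Finset.sum_mul_sum]
        exact Finset.sum_congr rfl fun k _ => Finset.sum_congr rfl fun l _ => by ring
      have e6 : ∀ k l, (∑ i : Fin n, ((x i k - 1 / 2) * (x i l - 1 / 2) -
          if k = l then (1 / 12 : ℝ) else 0)) * (b k * b l) =
          ∑ i, (x i k - 1 / 2) * (x i l - 1 / 2) * (b k * b l) -
            if k = l then n * (1 / 12) * (b k * b l) else 0 := by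
        intro k l
        rw [Finset.sum_sub_distrib, sub_mul, Finset.sum_mul]
        split_ifs <;> simp
      simp only [e6]
      simp only [e5, Finset.sum_sub_distrib]
      congr 1
      · rw [Finset.sum_comm]
        refine Finset.sum_congr rfl fun k _ => ?_
        rw [Finset.sum_comm]
      · rw [Finset.mul_sum]
        refine Finset.sum_congr rfl fun k _ => ?_
        simp [sq]
    rw [this, sq, ha, Finset.sum_mul_sum, Finset.mul_sum]
    refine (Finset.abs_sum_le_sum_abs _ _).trans (Finset.sum_le_sum fun k _ => ?_)
    rw [Finset.mul_sum]
    refine (Finset.abs_sum_le_sum_abs _ _).trans (Finset.sum_le_sum fun l _ => ?_)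
    rw [abs_mul, abs_mul]
    exact mul_le_mul_of_nonneg_right (h2 k l) (by positivity)
  have e6 : (∑ j, y j) ^ 2 ≤ (n * (1 / 200) * a) ^ 2 :=
    sq_le_sq' (abs_le.1 e3).1 (abs_le.1 e3).2
  have e7 : 1 / (n : ℝ) * (∑ j, y j) ^ 2 ≤ n * (1 / 40000) * a ^ 2 := by
    rw [one_div, inv_mul_le_iff₀ hn']
    refine e6.trans (le_of_eq (by ring))
  have e8 := mul_le_mul_of_nonneg_left ha2 hn'.le
  have e9 : 0 ≤ (n : ℝ) * ∑ k, b k ^ 2 :=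
    mul_nonneg hn'.le (Finset.sum_nonneg fun _ _ => sq_nonneg _)
  rw [e2]
  have e10 := (abs_le.1 e4).1
  nlinarith

end Configuration

section Hops

/-- The lower corner of a box with sides `a` that lies in the unit cube and contains `y`
(if `y` lies in the unit cube). -/
def boxCorner {d : ℕ} (a : ℝ) (y : Fin d → ℝ) : Fin d → ℝ :=
  fun k => max 0 (min 1 (y k)) * (1 - a)

/-- A box with sides `a` that lies in the unit cube and contains `y`. -/
def cubeBox {d : ℕ} (a : ℝ) (y : Fin d → ℝ) : Set (Fin d → ℝ) :=
  Set.univ.pi fun k => Set.Icc (boxCorner a y k) (boxCorner a y k + a)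

/-- The point that divides the segment from `x` to `y` in the ratio `c : 1 - c`. -/
def segPoint {d : ℕ} (c : ℝ) (x y : Fin d → ℝ) : Fin d → ℝ := fun k => x k + c * (y k - x k)

theorem segPoint_mem_cube {d : ℕ} {c : ℝ} (hc0 : 0 ≤ c) (hc1 : c ≤ 1) {x y : Fin d → ℝ}
    (hx : ∀ k, x k ∈ Set.Icc (0 : ℝ) 1) (hy : ∀ k, y k ∈ Set.Icc (0 : ℝ) 1) (k : Fin d) :
    segPoint c x y k ∈ Set.Icc (0 : ℝ) 1 := by
  obtain ⟨h1, h2⟩ := hx k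
  obtain ⟨h3, h4⟩ := hy k
  constructor <;> simp only [segPoint] <;> nlinarith

theorem eucDist_eq_of_sq {d : ℕ} {x y : Fin d → ℝ} {r : ℝ} (hr : 0 ≤ r)
    (h : ∑ k, (x k - y k) ^ 2 = r ^ 2) : eucDist x y = r := by
  rw [← eucDist_sq] at h
  exact (sq_eq_sq₀ (eucDist_nonneg _ _) hr).1 h

theorem eucDist_segPoint_left {d : ℕ} {c : ℝ} (hc0 : 0 ≤ c) (x y : Fin d → ℝ) :
    eucDist x (segPoint c x y) = c * eucDist x y := by
  refine eucDist_eq_of_sq (mul_nonneg hc0 (eucDist_nonneg _ _)) ?_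
  rw [mul_pow, eucDist_sq, Finset.mul_sum]
  exact Finset.sum_congr rfl fun k _ => by simp only [segPoint]; ring

theorem eucDist_segPoint_right {d : ℕ} {c : ℝ} (hc1 : c ≤ 1) (x y : Fin d → ℝ) :
    eucDist (segPoint c x y) y = (1 - c) * eucDist x y := by
  refine eucDist_eq_of_sq (mul_nonneg (by linarith) (eucDist_nonneg _ _)) ?_
  rw [mul_pow, eucDist_sq, Finset.mul_sum]
  exact Finset.sum_congr rfl fun k _ => by simp only [segPoint]; ring

theorem eucDist_le_of_abs_sub_le {d : ℕ} (hd : d ≤ 3) {a : ℝ} (ha : 0 ≤ a) {x y : Fin d → ℝ}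
    (h : ∀ k, |x k - y k| ≤ a) : eucDist x y ≤ 1.7325 * a := by
  refine (sq_le_sq₀ (eucDist_nonneg _ _) (by positivity)).1 ?_
  have hd' : (d : ℝ) ≤ 3 := by exact_mod_cast hd
  calc eucDist x y ^ 2 = ∑ k, (x k - y k) ^ 2 := eucDist_sq x y
    _ ≤ ∑ _k : Fin d, a ^ 2 :=
        Finset.sum_le_sum fun k _ => sq_le_sq' (abs_le.1 (h k)).1 (abs_le.1 (h k)).2
    _ = d * a ^ 2 := by simp
    _ ≤ (1.7325 * a) ^ 2 := by nlinarith [sq_nonneg a]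

theorem eucDist_le_of_mem_cubeBox {d : ℕ} (hd : d ≤ 3) {a : ℝ} (ha : 0 ≤ a)
    {y v : Fin d → ℝ} (hy : ∀ k, y k ∈ Set.Icc (0 : ℝ) 1) (hv : v ∈ cubeBox a y) :
    eucDist v y ≤ 1.7325 * a := by
  refine eucDist_le_of_abs_sub_le hd ha fun k => ?_
  obtain ⟨h0, h1⟩ := hy k
  have hk := hv k (Set.mem_univ k)
  simp only [boxCorner, Set.mem_Icc] at hk
  rw [min_eq_right h1, max_eq_right h0] at hk
  obtain ⟨h2, h3⟩ := hk
  rw [abs_le]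
  constructor <;> nlinarith

theorem le_detectProb {α β R z : ℝ} (hα0 : 0 < α) (hα1 : α ≤ 1) (hβ : 0 ≤ β) (hR : 0 < R)
    (hz0 : 0 ≤ z) (hz : z ≤ R) : α ≤ detectProb α β R z := by
  unfold detectProb
  split_ifs with h
  · exact hα1
  · refine le_min hα1 (le_mul_of_one_le_right hα0.le ?_)
    rcases hz0.eq_or_lt with h0 | h0
    · have : β = 0 := le_antisymm (not_lt.1 fun hb => h ⟨h0.symm, hb⟩) hβ
      simp [this]
    · exact Real.one_le_rpow_of_pos_of_le_one_of_nonpos (div_pos h0 hR)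
        ((div_le_one hR).2 hz) (by linarith)

theorem graph_adj_of_le {n d : ℕ} {α β R : ℝ} (hα0 : 0 < α) (hα1 : α ≤ 1) (hβ : 0 ≤ β)
    (hR : 0 < R) (ω : Sample n d) {i j : Fin n} (hij : i ≠ j)
    (hd : eucDist (ω.1 i) (ω.1 j) ≤ R) (hm : ω.2 s(i, j) ≤ α) : (graph α β R ω).Adj i j :=
  ⟨hij, hd, hm.trans (le_detectProb hα0 hα1 hβ hR (eucDist_nonneg _ _) hd)⟩

theorem eucDist_le_mul_length {n d : ℕ} {α β R : ℝ} (ω : Sample n d) {i j : Fin n}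
    (p : (graph α β R ω).Walk i j) : eucDist (ω.1 i) (ω.1 j) ≤ R * p.length := by
  induction p with
  | nil => simp [eucDist]
  | cons h p ih =>
    refine (eucDist_triangle _ _ _).trans ((add_le_add h.2.1 ih).trans (le_of_eq ?_))
    rw [SimpleGraph.Walk.length_cons]
    push_cast
    ring

/-- Every pair of nodes has a witness near the point at distance about `t` from the first node on
the segment to the second, joined to the first node by a good mark. -/
def GreedyStep {n d : ℕ} (α a t : ℝ) (ω : Sample n d) : Prop :=
  ∀ u j : Fin n, u ≠ j → ∃ w, w ≠ u ∧ w ≠ j ∧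
    ω.1 w ∈ cubeBox a (segPoint (min 1 (t / eucDist (ω.1 u) (ω.1 j))) (ω.1 u) (ω.1 j)) ∧
    ω.2 s(u, w) ≤ α

/-- Every pair of nodes has a witness near its midpoint, joined to both nodes by good marks. -/
def CommonNeighbor {n d : ℕ} (α a : ℝ) (ω : Sample n d) : Prop :=
  ∀ u j : Fin n, u ≠ j → ∃ w, w ≠ u ∧ w ≠ j ∧
    ω.1 w ∈ cubeBox a (segPoint (1 / 2) (ω.1 u) (ω.1 j)) ∧ ω.2 s(u, w) ≤ α ∧ ω.2 s(j, w) ≤ α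

theorem exists_walk_of_commonNeighbor {n d : ℕ} (hd : d ≤ 3) {α β R a : ℝ} (hα0 : 0 < α)
    (hα1 : α ≤ 1) (hβ : 0 ≤ β) (hR : 0 < R) (ω : Sample n d)
    (hω : ∀ i k, ω.1 i k ∈ Set.Icc (0 : ℝ) 1) (ha : 0 ≤ a) (haR : 32 * a ≤ R)
    (hc : CommonNeighbor α a ω) (u j : Fin n) (h : eucDist (ω.1 u) (ω.1 j) ≤ R) :
    ∃ p : (graph α β R ω).Walk u j, p.length ≤ 2 := by
  rcases eq_or_ne u j with rfl | huj
  · exact ⟨SimpleGraph.Walk.nil, by simp⟩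
  obtain ⟨w, hwu, hwj, hw, h1, h2⟩ := hc u j huj
  set y := segPoint (1 / 2) (ω.1 u) (ω.1 j) with hy
  have hwy : eucDist (ω.1 w) y ≤ 1.7325 * a :=
    eucDist_le_of_mem_cubeBox hd ha
      (segPoint_mem_cube (by norm_num) (by norm_num) (hω u) (hω j)) hw
  have e1 : eucDist (ω.1 u) y = 1 / 2 * eucDist (ω.1 u) (ω.1 j) :=
    eucDist_segPoint_left (by norm_num) _ _
  have e2 : eucDist y (ω.1 j) = (1 - 1 / 2) * eucDist (ω.1 u) (ω.1 j) :=
    eucDist_segPoint_right (by norm_num) _ _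
  have hu : (graph α β R ω).Adj u w := by
    refine graph_adj_of_le hα0 hα1 hβ hR ω hwu.symm ?_ h1
    have := eucDist_triangle (ω.1 u) y (ω.1 w)
    rw [eucDist_comm y] at this
    linarith
  have hj : (graph α β R ω).Adj j w := by
    refine graph_adj_of_le hα0 hα1 hβ hR ω hwj.symm ?_ h2
    have := eucDist_triangle (ω.1 w) y (ω.1 j)
    rw [eucDist_comm (ω.1 j)]
    linarith
  exact ⟨SimpleGraph.Walk.cons hu (SimpleGraph.Walk.cons hj.symm SimpleGraph.Walk.nil), by simp⟩

theorem exists_walk_le {n d : ℕ} (hd : d ≤ 3) {α β R s a : ℝ} (hα0 : 0 < α)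
    (hα1 : α ≤ 1) (hβ : 0 ≤ β) (hR : 0 < R) (ω : Sample n d)
    (hω : ∀ i k, ω.1 i k ∈ Set.Icc (0 : ℝ) 1) (ha : 0 ≤ a) (haR : 32 * a ≤ R)
    (hs : 0 ≤ s) (hsR : 32 * s ≤ R)
    (hg : GreedyStep α (2 / 3 * s) (R - 1.155 * s) ω)
    (hc : CommonNeighbor α a ω) (m : ℕ) (u j : Fin n)
    (h : eucDist (ω.1 u) (ω.1 j) ≤ R + m * (R - 2.31 * s)) :
    ∃ p : (graph α β R ω).Walk u j, p.length ≤ m + 2 := by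
  induction m generalizing u with
  | zero =>
    simpa using exists_walk_of_commonNeighbor hd hα0 hα1 hβ hR ω hω ha haR hc u j (by simpa using h)
  | succ m ih =>
    rcases le_or_gt (eucDist (ω.1 u) (ω.1 j)) R with hle | hgt
    · obtain ⟨p, hp⟩ := exists_walk_of_commonNeighbor hd hα0 hα1 hβ hR ω hω ha haR hc u j hle
      exact ⟨p, by omega⟩
    have huj : u ≠ j := by
      rintro rfl
      have : eucDist (ω.1 u) (ω.1 u) = 0 := by simp [eucDist]
      linarith
    obtain ⟨w, hwu, hwj, hw, h1⟩ := hg u j huj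
    set ρ := eucDist (ω.1 u) (ω.1 j) with hρ
    have hρ0 : 0 < ρ := hR.trans hgt
    set c := min 1 ((R - 1.155 * s) / ρ) with hc
    have hc1 : c ≤ 1 := min_le_left _ _
    have hcρ : c * ρ = R - 1.155 * s := by
      rw [hc, min_eq_right, div_mul_cancel₀ _ hρ0.ne']
      rw [div_le_one hρ0]
      linarith
    have hc0 : 0 ≤ c := le_min zero_le_one (div_nonneg (by linarith) hρ0.le)
    set y := segPoint c (ω.1 u) (ω.1 j) with hy
    have hwy : eucDist (ω.1 w) y ≤ 1.7325 * (2 / 3 * s) :=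
      eucDist_le_of_mem_cubeBox hd (by positivity) (segPoint_mem_cube hc0 hc1 (hω u) (hω j)) hw
    have e1 : eucDist (ω.1 u) y = c * ρ := eucDist_segPoint_left hc0 _ _
    have e2 : eucDist y (ω.1 j) = (1 - c) * ρ := eucDist_segPoint_right hc1 _ _
    have hu : (graph α β R ω).Adj u w := by
      refine graph_adj_of_le hα0 hα1 hβ hR ω hwu.symm ?_ h1
      have := eucDist_triangle (ω.1 u) y (ω.1 w)
      rw [eucDist_comm y] at this
      linarith
    obtain ⟨p, hp⟩ := ih w (by
      have := eucDist_triangle (ω.1 w) y (ω.1 j)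
      push_cast at h
      linarith)
    exact ⟨SimpleGraph.Walk.cons hu p, by rw [SimpleGraph.Walk.length_cons]; omega⟩

theorem mul_dist_le {n d : ℕ} (hd : d ≤ 3) {α β R s a : ℝ} (hα0 : 0 < α)
    (hα1 : α ≤ 1) (hβ : 0 ≤ β) (hR : 0 < R) (ω : Sample n d)
    (hω : ∀ i k, ω.1 i k ∈ Set.Icc (0 : ℝ) 1) (ha : 0 ≤ a) (haR : 32 * a ≤ R)
    (hs : 0 ≤ s) (hsR : 32 * s ≤ R)
    (hg : GreedyStep α (2 / 3 * s) (R - 1.155 * s) ω)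
    (hc : CommonNeighbor α a ω) (u j : Fin n) :
    (graph α β R ω).Reachable u j ∧ R * (graph α β R ω).dist u j ≤
      eucDist (ω.1 u) (ω.1 j) * (1 + 2.5 * (s / R)) + 2 * R := by
  set ρ := eucDist (ω.1 u) (ω.1 j) with hρ
  have hρ0 : 0 ≤ ρ := eucDist_nonneg _ _
  have hτ : 0 < R - 2.31 * s := by linarith
  set m := ⌈(ρ - R) / (R - 2.31 * s)⌉₊ with hm
  obtain ⟨p, hp⟩ := exists_walk_le hd hα0 hα1 hβ hR ω hω ha haR hs hsR hg hc m u j (by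
    have h1 := Nat.le_ceil ((ρ - R) / (R - 2.31 * s))
    rw [div_le_iff₀ hτ] at h1
    rw [← hρ, hm]
    linarith)
  refine ⟨p.reachable, ?_⟩
  have h1 : ((graph α β R ω).dist u j : ℝ) ≤ m + 2 := by
    exact_mod_cast (SimpleGraph.dist_le p).trans hp
  have hq : s / R * R = s := div_mul_cancel₀ _ hR.ne'
  have hq0 : 0 ≤ s / R := by positivity
  have hq1 : s / R ≤ 1 / 32 := by rw [div_le_iff₀ hR]; linarith
  have h2 : (m : ℝ) * (R - 2.31 * s) ≤ ρ := by
    rcases le_or_gt ρ R with h | h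
    · have : m = 0 := Nat.ceil_eq_zero.2 (div_nonpos_of_nonpos_of_nonneg (by linarith) hτ.le)
      rw [this]
      simpa using hρ0
    · have h3 := Nat.ceil_lt_add_one (div_nonneg (sub_nonneg.2 h.le) hτ.le)
      have h4 : (m : ℝ) * (R - 2.31 * s) ≤ ((ρ - R) / (R - 2.31 * s) + 1) * (R - 2.31 * s) :=
        mul_le_mul_of_nonneg_right h3.le hτ.le
      rw [add_mul, div_mul_cancel₀ _ hτ.ne'] at h4
      linarith
  have h3 : (m : ℝ) * R ≤ ρ * (1 + 2.5 * (s / R)) := by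
    have h4 : R ≤ (R - 2.31 * s) * (1 + 2.5 * (s / R)) := by
      have : (R - 2.31 * s) * (1 + 2.5 * (s / R)) =
          R + (s / R * R) * (0.19 - 5.775 * (s / R)) := by
        field_simp
        ring
      rw [this]
      have : 0 ≤ (s / R * R) * (0.19 - 5.775 * (s / R)) :=
        mul_nonneg (by positivity) (by linarith)
      linarith
    calc (m : ℝ) * R ≤ m * ((R - 2.31 * s) * (1 + 2.5 * (s / R))) :=
          mul_le_mul_of_nonneg_left h4 (Nat.cast_nonneg _)
      _ = (m * (R - 2.31 * s)) * (1 + 2.5 * (s / R)) := by ring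
      _ ≤ _ := mul_le_mul_of_nonneg_right h2 (by positivity)
  nlinarith [mul_le_mul_of_nonneg_left h1 hR.le]

theorem abs_sqPathMatrix_sub_le {n d : ℕ} (hd : d ≤ 3) {α β R s a : ℝ} (hα0 : 0 < α)
    (hα1 : α ≤ 1) (hβ : 0 ≤ β) (hR : 0 < R) (ω : Sample n d)
    (hω : ∀ i k, ω.1 i k ∈ Set.Icc (0 : ℝ) 1) (ha : 0 ≤ a) (haR : 32 * a ≤ R)
    (hs : 0 ≤ s) (hsR : 32 * s ≤ R)
    (hg : GreedyStep α (2 / 3 * s) (R - 1.155 * s) ω)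
    (hc : CommonNeighbor α a ω) (u j : Fin n) :
    |sqPathMatrix R (graph α β R ω) u j - eucDist (ω.1 u) (ω.1 j) ^ 2| ≤
      15.6 * (s / R) + 7.5 * R + 4 * R ^ 2 := by
  obtain ⟨hr, hle⟩ := mul_dist_le (β := β) hd hα0 hα1 hβ hR ω hω ha haR hs hsR hg hc u j
  obtain ⟨p, hp⟩ := hr.exists_walk_length_eq_dist
  have hge := eucDist_le_mul_length ω p
  rw [hp] at hge
  set ρ := eucDist (ω.1 u) (ω.1 j) with hρ
  have hρ0 : 0 ≤ ρ := eucDist_nonneg _ _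
  have hρ1 : ρ ≤ 1.7325 := by
    have := eucDist_le_of_abs_sub_le hd zero_le_one (x := ω.1 u) (y := ω.1 j) fun k => by
      obtain ⟨h1, h2⟩ := hω u k
      obtain ⟨h3, h4⟩ := hω j k
      rw [abs_le]
      constructor <;> linarith
    linarith
  have hρ2 : ρ ^ 2 ≤ 3 := by
    rw [hρ, eucDist_sq]
    have hd' : (d : ℝ) ≤ 3 := by exact_mod_cast hd
    refine le_trans (Finset.sum_le_sum (g := fun _ => (1 : ℝ)) fun k _ => ?_) (by simpa using hd')
    obtain ⟨h1, h2⟩ := hω u k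
    obtain ⟨h3, h4⟩ := hω j k
    rw [sq_le_one_iff_abs_le_one, abs_le]
    constructor <;> linarith
  have hq0 : 0 ≤ s / R := by positivity
  have hq1 : s / R ≤ 1 / 32 := by rw [div_le_iff₀ hR]; linarith
  set q := s / R with hqdef
  have h1 : (R * (graph α β R ω).dist u j : ℝ) ^ 2 ≤ (ρ * (1 + 2.5 * q) + 2 * R) ^ 2 :=
    pow_le_pow_left₀ (by positivity) hle 2
  have h2 : ρ ^ 2 ≤ (R * (graph α β R ω).dist u j : ℝ) ^ 2 := pow_le_pow_left₀ hρ0 hge 2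
  have e : sqPathMatrix R (graph α β R ω) u j = (R * (graph α β R ω).dist u j : ℝ) ^ 2 := rfl
  rw [e, abs_of_nonneg (by linarith)]
  have h3 : (ρ * (1 + 2.5 * q) + 2 * R) ^ 2 - ρ ^ 2 =
      ρ ^ 2 * (5 * q + 6.25 * (q * q)) + 4 * R * (ρ * (1 + 2.5 * q)) + 4 * R ^ 2 := by ring
  have h4 : q * q ≤ 1 / 32 * q := mul_le_mul_of_nonneg_right hq1 hq0
  have h5 : ρ ^ 2 * (5 * q + 6.25 * (q * q)) ≤ 3 * (5 * q + 6.25 * (q * q)) :=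
    mul_le_mul_of_nonneg_right hρ2 (by positivity)
  have h6 : ρ * (1 + 2.5 * q) ≤ 1.7325 * (1 + 2.5 * (1 / 32)) :=
    mul_le_mul hρ1 (by linarith) (by positivity) (by norm_num)
  have h7 := mul_le_mul_of_nonneg_left h6 (by positivity : 0 ≤ 4 * R)
  nlinarith

/-- The deterministic part of the analysis of MDS-MAP. -/
theorem connected_and_frobNorm_le {n d : ℕ} (hn : n ≠ 0) (hdn : d ≤ n) (hd : d ≤ 3)
    {α β R s a : ℝ} (hα0 : 0 < α)
    (hα1 : α ≤ 1) (hβ : 0 ≤ β) (hR : 0 < R) (ω : Sample n d)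
    (hω : ∀ i k, ω.1 i k ∈ Set.Icc (0 : ℝ) 1) (ha : 0 ≤ a) (haR : 32 * a ≤ R)
    (hs : 0 ≤ s) (hsR : 32 * s ≤ R)
    (hg : GreedyStep α (2 / 3 * s) (R - 1.155 * s) ω)
    (hc : CommonNeighbor α a ω)
    (h1 : ∀ k, |∑ i, (ω.1 i k - 1 / 2)| ≤ n * (1 / 200))
    (h2 : ∀ k l, |∑ i, ((ω.1 i k - 1 / 2) * (ω.1 i l - 1 / 2) - if k = l then 1 / 12 else 0)| ≤
      n * (1 / 200)) :
    (graph α β R ω).Connected ∧ ∀ Y : Matrix (Fin n) (Fin d) ℝ,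
      IsMDSMapOutput R (graph α β R ω) Y → ∃ S : Matrix (Fin d) (Fin d) ℝ,
        1 / Real.sqrt n * frobNorm (centering n * posMatrix ω - centering n * Y * S) ≤
          Real.sqrt 6 * (32 * s / R + 20 * R) := by
  have h6 : 2.44 ≤ Real.sqrt 6 := Real.le_sqrt_of_sq_le (by norm_num)
  have hq0 : 0 ≤ s / R := by positivity
  have hb : 2.44 * (32 * s / R + 20 * R) ≤ Real.sqrt 6 * (32 * s / R + 20 * R) :=
    mul_le_mul_of_nonneg_right h6 (by positivity)
  rw [mul_div_assoc] at hb ⊢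
  refine ⟨?_, fun Y hY => ?_⟩
  · have : Nonempty (Fin n) := ⟨⟨0, Nat.pos_of_ne_zero hn⟩⟩
    exact ⟨fun u j => (mul_dist_le hd hα0 hα1 hβ hR ω hω ha haR hs hsR hg hc u j).1⟩
  · rcases le_or_gt R 1 with hR1 | hR1
    · obtain ⟨S, hS⟩ := exists_frobNorm_le_of_sq_dist_error hn hdn ω.1 _ (by positivity)
        (abs_sqPathMatrix_sub_le (β := β) hd hα0 hα1 hβ hR ω hω ha haR hs hsR hg hc)
        (centering_quadratic_form_ge hn hd ω.1 h1 h2) Y hY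
      refine ⟨S, hS.trans (le_trans ?_ hb)⟩
      nlinarith
    · refine ⟨0, ?_⟩
      rw [Matrix.mul_zero, sub_zero]
      refine (frobNorm_centering_mul_le hn ω.1 hω).trans (le_trans ?_ hb)
      have : Real.sqrt d ≤ 2 := by
        rw [Real.sqrt_le_left (by norm_num)]
        have hd' : (d : ℝ) ≤ 3 := by exact_mod_cast hd
        linarith
      nlinarith

end Hops

section Law

instance isProbabilityMeasure_unif01 : IsProbabilityMeasure unif01 :=
  ⟨by simp [unif01]⟩

instance isProbabilityMeasure_law (n d : ℕ) : IsProbabilityMeasure (law n d) := by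
  unfold law
  infer_instance

theorem unif01_Icc {a b : ℝ} (ha : 0 ≤ a) (hb : b ≤ 1) :
    unif01 (Set.Icc a b) = ENNReal.ofReal (b - a) := by
  rw [unif01, Measure.restrict_apply measurableSet_Icc,
    Set.inter_eq_left.2 (Set.Icc_subset_Icc ha hb), Real.volume_Icc]

theorem unif01_Iic {a : ℝ} (ha : a ≤ 1) : unif01 (Set.Iic a) = ENNReal.ofReal a := by
  rw [unif01, Measure.restrict_apply measurableSet_Iic, ← Set.Ici_inter_Iic, Set.inter_comm,
    Set.inter_assoc]
  have : Set.Iic (1 : ℝ) ∩ Set.Iic a = Set.Iic a :=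
    Set.inter_eq_right.2 (Set.Iic_subset_Iic.2 ha)
  rw [this, Set.Ici_inter_Iic, Real.volume_Icc, sub_zero]

theorem measurableSet_cubeBox {d : ℕ} (a : ℝ) (y : Fin d → ℝ) : MeasurableSet (cubeBox a y) :=
  MeasurableSet.univ_pi fun _ => measurableSet_Icc

theorem pi_unif01_cubeBox {d : ℕ} {a : ℝ} (ha0 : 0 ≤ a) (ha1 : a ≤ 1) (y : Fin d → ℝ) :
    (Measure.pi fun _ : Fin d => unif01) (cubeBox a y) = ENNReal.ofReal (a ^ d) := by
  rw [cubeBox, Measure.pi_pi, ENNReal.ofReal_pow ha0]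
  have (k : Fin d) : unif01 (Set.Icc (boxCorner a y k) (boxCorner a y k + a)) =
      ENNReal.ofReal a := by
    have h0 : 0 ≤ max 0 (min 1 (y k)) := le_max_left _ _
    have h1 : max 0 (min 1 (y k)) ≤ 1 := max_le zero_le_one (min_le_left _ _)
    rw [unif01_Icc]
    · congr 1; ring
    · exact mul_nonneg h0 (by linarith)
    · simp only [boxCorner]
      nlinarith
  simp [this]

/-- Failure of groups of marks that are disjoint from each other. -/
theorem pi_unif01_real_disjoint_groups {ι κ : Type*} [Fintype ι] [DecidableEq ι] {α : ℝ}
    (hα0 : 0 ≤ α) (hα1 : α ≤ 1) (T : κ → Finset ι) (S : Finset κ) :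
    ∀ F : Finset ι, (S : Set κ).PairwiseDisjoint T → (∀ w ∈ S, Disjoint F (T w)) →
    (Measure.pi fun _ : ι => unif01).real
      {m | (∀ w ∈ S, ¬ ∀ e ∈ T w, m e ≤ α) ∧ ∀ e ∈ F, m e ≤ α} =
      α ^ F.card * ∏ w ∈ S, (1 - α ^ (T w).card) := by
  classical
  induction S using Finset.induction_on with
  | empty =>
    intro F _ _
    have : {m : ι → ℝ | (∀ w ∈ (∅ : Finset κ), ¬ ∀ e ∈ T w, m e ≤ α) ∧ ∀ e ∈ F, m e ≤ α} =
        Set.univ.pi fun e => if e ∈ F then Set.Iic α else Set.univ := by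
      ext m
      simp only [Set.mem_ofPred_eq, Finset.notMem_empty, false_imp_iff, implies_true, true_and,
        Set.mem_pi, Set.mem_univ, true_imp_iff]
      refine forall_congr' fun e => ?_
      split_ifs with h <;> simp [h]
    rw [measureReal_def, this, Measure.pi_pi, ENNReal.toReal_prod]
    have h2 (e : ι) : (unif01 (if e ∈ F then Set.Iic α else Set.univ)).toReal =
        if e ∈ F then α else 1 := by
      split_ifs
      · rw [unif01_Iic hα1, ENNReal.toReal_ofReal hα0]
      · simp
    simp [h2]
  | insert w S hw ih =>
    intro F hT hF
    have hT' : (S : Set κ).PairwiseDisjoint T :=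
      hT.subset (by simp)
    have hS : ∀ v ∈ S, Disjoint F (T v) := fun v hv => hF v (Finset.mem_insert_of_mem hv)
    have hFw : Disjoint F (T w) := hF w (Finset.mem_insert_self _ _)
    have hS' : ∀ v ∈ S, Disjoint (F ∪ T w) (T v) := fun v hv => by
      rw [Finset.disjoint_union_left]
      refine ⟨hS v hv, hT ?_ ?_ ?_⟩
      · simp
      · simp [hv]
      · rintro rfl; exact hw hv
    have h1 := ih F hT' hS
    have h2 := ih (F ∪ T w) hT' hS'
    set B := {m : ι → ℝ | (∀ v ∈ S, ¬ ∀ e ∈ T v, m e ≤ α) ∧ ∀ e ∈ F, m e ≤ α} with hB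
    set C := {m : ι → ℝ | (∀ v ∈ S, ¬ ∀ e ∈ T v, m e ≤ α) ∧ ∀ e ∈ F ∪ T w, m e ≤ α} with hC
    have hCB : C ⊆ B := fun m hm => ⟨hm.1, fun e he => hm.2 e (Finset.mem_union_left _ he)⟩
    have hCm : MeasurableSet C := by
      have hH (H : Finset ι) : MeasurableSet {m : ι → ℝ | ∀ e ∈ H, m e ≤ α} := by
        have : {m : ι → ℝ | ∀ e ∈ H, m e ≤ α} = ⋂ e ∈ H, {m | m e ≤ α} := by ext; simp
        rw [this]
        exact Finset.measurableSet_biInter _ fun e _ =>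
          measurableSet_le (measurable_pi_apply e) measurable_const
      have : C = (⋂ v ∈ S, {m | ∀ e ∈ T v, m e ≤ α}ᶜ) ∩ {m | ∀ e ∈ F ∪ T w, m e ≤ α} := by
        ext
        simp [hC]
      rw [this]
      exact (Finset.measurableSet_biInter _ fun v _ => (hH _).compl).inter (hH _)
    have : {m : ι → ℝ | (∀ v ∈ insert w S, ¬ ∀ e ∈ T v, m e ≤ α) ∧ ∀ e ∈ F, m e ≤ α} =
        B \ C := by
      ext m
      simp only [hB, hC, Set.mem_ofPred_eq, Set.mem_sdiff, Finset.forall_mem_insert,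
        Finset.mem_union, or_imp, forall_and]
      tauto
    rw [this, measureReal_sdiff hCB hCm, h1, h2, Finset.prod_insert hw,
      Finset.card_union_of_disjoint hFw, pow_add]
    ring

/-- Conditioning on two coordinates of a product measure, the others being independent. -/
theorem lintegral_pi_two_coordinates_le {n : ℕ} {E : Type*} [MeasurableSpace E] (ν : Measure E)
    [IsProbabilityMeasure ν] {u j : Fin n} (huj : u ≠ j) (g : E → E → E → ENNReal)
    (hg : Measurable fun z : E × E × E => g z.1 z.2.1 z.2.2) {c : ENNReal}
    (hc : ∀ p q, ∫⁻ v, g p q v ∂ν ≤ c) :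
    ∫⁻ x : Fin n → E, ∏ w ∈ Finset.univ.filter (fun w => w ≠ u ∧ w ≠ j), g (x u) (x j) (x w)
      ∂(Measure.pi fun _ => ν) ≤ c ^ (n - 2) := by
  classical
  let P : Fin n → Prop := fun i => i = u ∨ i = j
  have hmp := measurePreserving_piEquivPiSubtypeProd (fun _ : Fin n => ν) P
  let f : ({i // P i} → E) × ({i // ¬ P i} → E) → ENNReal := fun z =>
    ∏ w : {i // ¬ P i}, g (z.1 ⟨u, Or.inl rfl⟩) (z.1 ⟨j, Or.inr rfl⟩) (z.2 w)
  have hf : Measurable f := by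
    refine Finset.measurable_prod _ fun w _ => ?_
    exact hg.comp (f := fun z : ({i // P i} → E) × ({i // ¬ P i} → E) =>
      (z.1 ⟨u, Or.inl rfl⟩, z.1 ⟨j, Or.inr rfl⟩, z.2 w)) (by fun_prop)
  have hcard : Fintype.card {i // ¬ P i} = n - 2 := by
    rw [Fintype.card_subtype_compl, Fintype.card_fin]
    congr 1
    rw [Fintype.card_subtype]
    have : Finset.univ.filter P = {u, j} := by
      ext i; simp [P]
    rw [this, Finset.card_pair huj]
  have e1 : ∀ x : Fin n → E,
      ∏ w ∈ Finset.univ.filter (fun w => w ≠ u ∧ w ≠ j), g (x u) (x j) (x w) =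
      f (MeasurableEquiv.piEquivPiSubtypeProd (fun _ : Fin n => E) P x) := by
    intro x
    rw [Finset.prod_subtype (p := fun i => ¬ P i) _ (by simp [P])]
    rfl
  simp only [e1]
  rw [hmp.lintegral_comp hf, lintegral_prod _ hf.aemeasurable]
  have e2 : ∀ a : {i // P i} → E, ∫⁻ b, f (a, b) ∂(Measure.pi fun _ => ν) ≤ c ^ (n - 2) := by
    intro a
    have hm : Measurable (g (a ⟨u, Or.inl rfl⟩) (a ⟨j, Or.inr rfl⟩)) :=
      hg.comp (f := fun v => (a ⟨u, Or.inl rfl⟩, a ⟨j, Or.inr rfl⟩, v)) (by fun_prop)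
    rw [ProbabilityTheory.lintegral_prod_eq_prod_lintegral_of_indepFun Finset.univ
      (fun (w : {i // ¬ P i}) (b : {i // ¬ P i} → E) =>
        g (a ⟨u, Or.inl rfl⟩) (a ⟨j, Or.inr rfl⟩) (b w))
      (ProbabilityTheory.iIndepFun_pi (μ := fun _ : {i // ¬ P i} => ν)
        (X := fun _ => g (a ⟨u, Or.inl rfl⟩) (a ⟨j, Or.inr rfl⟩)) fun _ => hm.aemeasurable)
      (fun w => hm.comp (measurable_pi_apply w))]
    rw [← hcard, ← Finset.card_univ]
    refine Finset.prod_le_pow_card _ _ _ fun w _ => ?_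
    rw [(measurePreserving_eval (fun _ : {i // ¬ P i} => ν) w).lintegral_comp hm]
    exact hc _ _
  refine (lintegral_mono e2).trans ?_
  simp

theorem measurableSet_mem_cubeBox {Ω : Type*} [MeasurableSpace Ω] {d : ℕ} (a : ℝ)
    {y v : Ω → Fin d → ℝ} (hy : Measurable y) (hv : Measurable v) :
    MeasurableSet {ω | v ω ∈ cubeBox a (y ω)} := by
  have : {ω | v ω ∈ cubeBox a (y ω)} = ⋂ k, ({ω | max 0 (min 1 (y ω k)) * (1 - a) ≤ v ω k} ∩
      {ω | v ω k ≤ max 0 (min 1 (y ω k)) * (1 - a) + a}) := by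
    ext ω
    simp only [cubeBox, boxCorner, Set.mem_univ_pi, Set.mem_Icc, Set.mem_iInter,
      Set.mem_inter_iff, Set.mem_ofPred_eq]
  rw [this]
  refine MeasurableSet.iInter fun k => MeasurableSet.inter ?_ ?_
  · exact measurableSet_le (by fun_prop) (by fun_prop)
  · exact measurableSet_le (by fun_prop) (by fun_prop)

/-- The probability that a given pair of nodes has no good witness in its box. -/
theorem law_no_witness_le {n d : ℕ} {α a : ℝ} (hα0 : 0 ≤ α) (hα1 : α ≤ 1) (ha0 : 0 ≤ a)
    (ha1 : a ≤ 1) {u j : Fin n} (huj : u ≠ j)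
    (y : (Fin d → ℝ) → (Fin d → ℝ) → Fin d → ℝ)
    (hy : Measurable fun z : (Fin d → ℝ) × (Fin d → ℝ) => y z.1 z.2)
    (T : Fin n → Finset (Sym2 (Fin n))) {m : ℕ} (hTm : ∀ w, w ≠ u → w ≠ j → (T w).card = m)
    (hT : {w : Fin n | w ≠ u ∧ w ≠ j}.PairwiseDisjoint T) :
    law n d {ω | ∀ w, w ≠ u → w ≠ j → ω.1 w ∈ cubeBox a (y (ω.1 u) (ω.1 j)) →
      ¬ ∀ e ∈ T w, ω.2 e ≤ α} ≤ ENNReal.ofReal ((1 - α ^ m * a ^ d) ^ (n - 2)) := by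
  classical
  set B := {ω : Sample n d | ∀ w, w ≠ u → w ≠ j → ω.1 w ∈ cubeBox a (y (ω.1 u) (ω.1 j)) →
      ¬ ∀ e ∈ T w, ω.2 e ≤ α} with hB
  have hym : Measurable fun ω : Sample n d => y (ω.1 u) (ω.1 j) :=
    hy.comp (f := fun ω : Sample n d => (ω.1 u, ω.1 j)) (by fun_prop)
  have hBm : MeasurableSet B := by
    have : B = ⋂ w, ⋂ (_ : w ≠ u), ⋂ (_ : w ≠ j),
        ({ω : Sample n d | ω.1 w ∈ cubeBox a (y (ω.1 u) (ω.1 j))}ᶜ ∪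
          (⋂ e ∈ T w, {ω : Sample n d | ω.2 e ≤ α})ᶜ) := by
      ext ω
      simp only [hB, Set.mem_ofPred_eq, Set.mem_iInter, Set.mem_union, Set.mem_compl_iff]
      simp only [imp_iff_not_or]
    rw [this]
    refine MeasurableSet.iInter fun w => MeasurableSet.iInter fun _ => MeasurableSet.iInter fun _ =>
      ((measurableSet_mem_cubeBox a hym (by fun_prop)).compl).union
        (Finset.measurableSet_biInter _ fun e _ => ?_).compl
    exact measurableSet_le (by fun_prop) (by fun_prop)
  rw [law, Measure.prod_apply hBm]
  set c : ENNReal := ENNReal.ofReal (1 - α ^ m) with hc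
  have hαm : α ^ m ≤ 1 := pow_le_one₀ hα0 hα1
  let g : (Fin d → ℝ) → (Fin d → ℝ) → (Fin d → ℝ) → ENNReal := fun p q v =>
    if v ∈ cubeBox a (y p q) then c else 1
  have e1 : ∀ x : Fin n → Fin d → ℝ,
      (Measure.pi fun _ : Sym2 (Fin n) => unif01) (Prod.mk x ⁻¹' B) =
      ∏ w ∈ Finset.univ.filter (fun w => w ≠ u ∧ w ≠ j), g (x u) (x j) (x w) := by
    intro x
    set S := (Finset.univ.filter (fun w => w ≠ u ∧ w ≠ j)).filter
      (fun w => x w ∈ cubeBox a (y (x u) (x j))) with hS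
    have h := pi_unif01_real_disjoint_groups hα0 hα1 T S ∅
      (hT.subset fun w hw => by simp [hS] at hw; exact hw.1) (by simp)
    have e2 : Prod.mk x ⁻¹' B =
        {μ | (∀ w ∈ S, ¬ ∀ e ∈ T w, μ e ≤ α) ∧ ∀ e ∈ (∅ : Finset (Sym2 (Fin n))), μ e ≤ α} := by
      ext μ
      simp [hB, hS, and_imp]
    rw [e2, ← ofReal_measureReal, h]
    have e3 : ∏ w ∈ S, (1 - α ^ (T w).card) = ∏ w ∈ S, (1 - α ^ m) :=
      Finset.prod_congr rfl fun w hw => by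
        simp only [hS, Finset.mem_filter, Finset.mem_univ, true_and] at hw
        rw [hTm w hw.1.1 hw.1.2]
    simp only [g, Finset.prod_ite, Finset.prod_const, one_pow, mul_one]
    rw [e3, Finset.prod_const, hc, ← ENNReal.ofReal_pow (by linarith)]
    simp [hS]
  simp only [e1]
  rw [ENNReal.ofReal_pow (by
    have : a ^ d ≤ 1 := pow_le_one₀ ha0 ha1
    have : α ^ m * a ^ d ≤ 1 := mul_le_one₀ hαm (by positivity) this
    linarith)]
  refine lintegral_pi_two_coordinates_le _ huj g ?_ fun p q => ?_
  · refine Measurable.ite (measurableSet_mem_cubeBox a ?_ (by fun_prop)) measurable_const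
      measurable_const
    exact hy.comp (f := fun z : (Fin d → ℝ) × (Fin d → ℝ) × (Fin d → ℝ) => (z.1, z.2.1))
      (by fun_prop)
  · have hm := measurableSet_cubeBox a (y p q)
    have hv := pi_unif01_cubeBox ha0 ha1 (y p q)
    rw [← lintegral_add_compl _ hm]
    have h1 : ∫⁻ v in cubeBox a (y p q), g p q v ∂(Measure.pi fun _ : Fin d => unif01) =
        ENNReal.ofReal ((1 - α ^ m) * a ^ d) := by
      rw [setLIntegral_congr_fun hm (g := fun _ => c) fun v hv => by simp [g, hv]]
      rw [setLIntegral_const, hv, hc, ← ENNReal.ofReal_mul (by linarith)]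
    have h2 : ∫⁻ v in (cubeBox a (y p q))ᶜ, g p q v ∂(Measure.pi fun _ : Fin d => unif01) =
        ENNReal.ofReal (1 - a ^ d) := by
      rw [setLIntegral_congr_fun hm.compl (g := fun _ => 1) fun v hv => by
        have : v ∉ cubeBox a (y p q) := hv
        simp [g, this]]
      rw [setLIntegral_one, prob_compl_eq_one_sub hm, hv,
        ENNReal.ofReal_sub _ (by positivity), ENNReal.ofReal_one]
    rw [h1, h2, ← ENNReal.ofReal_add
      (mul_nonneg (by linarith) (by positivity)) (by linarith [pow_le_one₀ (n := d) ha0 ha1])]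
    exact ENNReal.ofReal_le_ofReal (by linarith)

end Law

section Probability

theorem integral_unif01 (f : ℝ → ℝ) : ∫ t, f t ∂unif01 = ∫ t in (0 : ℝ)..1, f t := by
  rw [unif01, integral_Icc_eq_integral_Ioc, ← intervalIntegral.integral_of_le zero_le_one]

theorem integral_unif01_sub_half : ∫ t, (t - 1 / 2) ∂unif01 = 0 := by
  rw [integral_unif01, intervalIntegral.integral_comp_sub_right (fun t => t), integral_id]
  norm_num

theorem integral_unif01_sub_half_sq : ∫ t, (t - 1 / 2) ^ 2 ∂unif01 = 1 / 12 := by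
  rw [integral_unif01, intervalIntegral.integral_comp_sub_right (fun t => t ^ 2), integral_pow]
  norm_num

theorem ae_pi_unif01_mem (d : ℕ) :
    ∀ᵐ v ∂(Measure.pi fun _ : Fin d => unif01), ∀ k, v k ∈ Set.Icc (0 : ℝ) 1 := by
  rw [ae_all_iff]
  intro k
  have h : ∀ᵐ t ∂unif01, t ∈ Set.Icc (0 : ℝ) 1 := ae_restrict_mem measurableSet_Icc
  exact (measurePreserving_eval (fun _ : Fin d => unif01) k).quasiMeasurePreserving.ae h

theorem ae_law_mem (n d : ℕ) : ∀ᵐ ω ∂(law n d), ∀ i k, ω.1 i k ∈ Set.Icc (0 : ℝ) 1 := by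
  rw [ae_all_iff]
  intro i
  have h := (measurePreserving_eval
    (fun _ : Fin n => Measure.pi fun _ : Fin d => unif01) i).quasiMeasurePreserving.ae
      (ae_pi_unif01_mem d)
  exact measurePreserving_fst.quasiMeasurePreserving.ae h

theorem integral_pi_unif01_sub_half {d : ℕ} (k : Fin d) :
    ∫ v, (v k - 1 / 2) ∂(Measure.pi fun _ : Fin d => unif01) = 0 := by
  rw [integral_comp_eval (μ := fun _ : Fin d => unif01) (i := k) (f := fun t => t - 1 / 2)
    (by fun_prop)]
  exact integral_unif01_sub_half

theorem integral_pi_unif01_cov {d : ℕ} (k l : Fin d) :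
    ∫ v, ((v k - 1 / 2) * (v l - 1 / 2)) ∂(Measure.pi fun _ : Fin d => unif01) =
      if k = l then 1 / 12 else 0 := by
  split_ifs with h
  · subst h
    simp only [← sq]
    rw [integral_comp_eval (μ := fun _ : Fin d => unif01) (i := k) (f := fun t => (t - 1 / 2) ^ 2)
      (by fun_prop)]
    exact integral_unif01_sub_half_sq
  · have e : ∀ v : Fin d → ℝ, (v k - 1 / 2) * (v l - 1 / 2) =
        ∏ i, (fun i t => if i = k ∨ i = l then t - 1 / 2 else 1 : Fin d → ℝ → ℝ) i (v i) := by
      intro v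
      rw [Finset.prod_eq_mul k l h]
      · simp
      · intro i _ hi
        simp [hi.1, hi.2]
      · simp
      · simp
    refine (integral_congr_ae (Filter.Eventually.of_forall e)).trans
      ((integral_fintype_prod_eq_prod (E := fun _ => ℝ) (μ := fun _ : Fin d => unif01)
        (fun i t => if i = k ∨ i = l then t - 1 / 2 else 1)).trans ?_)
    refine Finset.prod_eq_zero (Finset.mem_univ k) ?_
    simpa using integral_unif01_sub_half

/-- Chebyshev's inequality for the sum of a bounded centered function over the nodes. -/
theorem law_deviation_le {n d : ℕ} (hn : n ≠ 0) (f : (Fin d → ℝ) → ℝ) (hf : Measurable f)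
    (hb : ∀ v : Fin d → ℝ, (∀ k, v k ∈ Set.Icc (0 : ℝ) 1) → f v ∈ Set.Icc (-1 : ℝ) 1)
    (h0 : ∫ v, f v ∂(Measure.pi fun _ : Fin d => unif01) = 0) :
    law n d {ω | ¬ |∑ i, f (ω.1 i)| ≤ n * (1 / 200)} ≤ ENNReal.ofReal (40000 / n) := by
  have hn' : (0 : ℝ) < n := by exact_mod_cast Nat.pos_of_ne_zero hn
  set ν := Measure.pi fun _ : Fin d => unif01 with hν
  have hbν : ∀ᵐ v ∂ν, f v ∈ Set.Icc (-1 : ℝ) 1 := (ae_pi_unif01_mem d).mono hb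
  have hL : MemLp f 2 ν := memLp_of_bounded hbν hf.aestronglyMeasurable 2
  have hvar : ProbabilityTheory.variance f ν ≤ 1 :=
    (ProbabilityTheory.variance_le_sq_of_bounded hbν hf.aemeasurable).trans (by norm_num)
  set X : (Fin n → Fin d → ℝ) → ℝ := ∑ i, fun x => f (x i) with hX
  have hXa (x) : X x = ∑ i, f (x i) := by simp [hX]
  have hLi (i : Fin n) : MemLp (fun x : Fin n → Fin d → ℝ => f (x i)) 2 (Measure.pi fun _ => ν) :=
    hL.comp_measurePreserving (measurePreserving_eval (fun _ : Fin n => ν) i)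
  have hXL : MemLp X 2 (Measure.pi fun _ => ν) := memLp_finsetSum' _ fun i _ => hLi i
  have hXvar : ProbabilityTheory.variance X (Measure.pi fun _ => ν) ≤ n := by
    rw [hX, ProbabilityTheory.variance_sum_pi (X := fun _ => f) fun _ => hL]
    refine (Finset.sum_le_sum fun _ _ => hvar).trans (by simp)
  have hX0 : ∫ x, X x ∂(Measure.pi fun _ => ν) = 0 := by
    simp only [hXa]
    rw [integral_finsetSum _ fun i _ => (hLi i).integrable (by norm_num)]
    refine Finset.sum_eq_zero fun i _ => ?_
    rw [integral_comp_eval (μ := fun _ : Fin n => ν) (i := i) (f := f) hf.aestronglyMeasurable]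
    exact h0
  have hc := ProbabilityTheory.meas_ge_le_variance_div_sq hXL (c := n * (1 / 200)) (by positivity)
  rw [hX0] at hc
  have hXm : Measurable X := by
    have : X = fun x => ∑ i, f (x i) := funext hXa
    rw [this]
    fun_prop
  have hS : MeasurableSet {x | (n : ℝ) * (1 / 200) ≤ |X x - 0|} :=
    measurableSet_le measurable_const (by fun_prop)
  have hp : law n d (Prod.fst ⁻¹' {x | (n : ℝ) * (1 / 200) ≤ |X x - 0|}) =
      (Measure.pi fun _ => ν) {x | (n : ℝ) * (1 / 200) ≤ |X x - 0|} :=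
    measurePreserving_fst.measure_preimage hS.nullMeasurableSet
  refine (measure_mono fun ω hω => ?_).trans ((hp.trans_le hc).trans
    (ENNReal.ofReal_le_ofReal ?_))
  · simp only [Set.mem_preimage, Set.mem_ofPred_eq, sub_zero, hXa, not_le] at hω ⊢
    exact hω.le
  · rw [div_le_div_iff₀ (by positivity) hn']
    nlinarith

theorem law_not_greedyStep_le {n d : ℕ} {α a t : ℝ} (hα0 : 0 ≤ α) (hα1 : α ≤ 1) (ha0 : 0 ≤ a)
    (ha1 : a ≤ 1) : law n d {ω | ¬ GreedyStep α a t ω} ≤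
      ENNReal.ofReal (n ^ 2 * (1 - α ^ 1 * a ^ d) ^ (n - 2)) := by
  classical
  have hx : (0 : ℝ) ≤ 1 - α ^ 1 * a ^ d :=
    sub_nonneg.2 (mul_le_one₀ (pow_le_one₀ hα0 hα1) (by positivity) (pow_le_one₀ ha0 ha1))
  let y : (Fin d → ℝ) → (Fin d → ℝ) → Fin d → ℝ := fun p q =>
    segPoint (min 1 (t / eucDist p q)) p q
  have hy : Measurable fun z : (Fin d → ℝ) × (Fin d → ℝ) => y z.1 z.2 := by
    have hD : Measurable fun z : (Fin d → ℝ) × (Fin d → ℝ) => eucDist z.1 z.2 := by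
      unfold eucDist
      fun_prop
    simp only [y]
    unfold segPoint
    fun_prop
  let B : Fin n → Fin n → Set (Sample n d) := fun u j =>
    {ω | u ≠ j ∧ ∀ w, w ≠ u → w ≠ j → ω.1 w ∈ cubeBox a (y (ω.1 u) (ω.1 j)) →
      ¬ ∀ e ∈ ({s(u, w)} : Finset (Sym2 (Fin n))), ω.2 e ≤ α}
  have hB : ∀ u j, law n d (B u j) ≤ ENNReal.ofReal ((1 - α ^ 1 * a ^ d) ^ (n - 2)) := by
    intro u j
    rcases eq_or_ne u j with h | h
    · simp [B, h]
    · refine (measure_mono fun ω hω => hω.2).trans (law_no_witness_le hα0 hα1 ha0 ha1 h y hy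
        (fun w => {s(u, w)}) (by simp) ?_)
      rintro w ⟨hwu, _⟩ w' _ hww'
      simp [Function.onFun, hww', hwu]
  have hsub : {ω : Sample n d | ¬ GreedyStep α a t ω} ⊆ ⋃ u, ⋃ j, B u j := by
    intro ω hω
    simp only [GreedyStep, Set.mem_ofPred_eq, not_forall] at hω
    obtain ⟨u, j, huj, hω⟩ := hω
    simp only [Set.mem_iUnion]
    refine ⟨u, j, huj, fun w hwu hwj hw he => hω ⟨w, hwu, hwj, hw, he _ (by simp)⟩⟩
  calc law n d {ω | ¬ GreedyStep α a t ω} ≤ law n d (⋃ u, ⋃ j, B u j) := measure_mono hsub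
    _ ≤ ∑ u, law n d (⋃ j, B u j) := measure_iUnion_fintype_le _ _
    _ ≤ ∑ u : Fin n, ∑ j, law n d (B u j) :=
        Finset.sum_le_sum fun u _ => measure_iUnion_fintype_le _ _
    _ ≤ ∑ _u : Fin n, ∑ _j : Fin n, ENNReal.ofReal ((1 - α ^ 1 * a ^ d) ^ (n - 2)) :=
        Finset.sum_le_sum fun u _ => Finset.sum_le_sum fun j _ => hB u j
    _ = ENNReal.ofReal (n ^ 2 * (1 - α ^ 1 * a ^ d) ^ (n - 2)) := by
        rw [ENNReal.ofReal_mul (by positivity), ENNReal.ofReal_pow (by positivity)]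
        simp [sq, mul_assoc]

theorem law_not_commonNeighbor_le {n d : ℕ} {α a : ℝ} (hα0 : 0 ≤ α) (hα1 : α ≤ 1) (ha0 : 0 ≤ a)
    (ha1 : a ≤ 1) : law n d {ω | ¬ CommonNeighbor α a ω} ≤
      ENNReal.ofReal (n ^ 2 * (1 - α ^ 2 * a ^ d) ^ (n - 2)) := by
  classical
  have hx : (0 : ℝ) ≤ 1 - α ^ 2 * a ^ d :=
    sub_nonneg.2 (mul_le_one₀ (pow_le_one₀ hα0 hα1) (by positivity) (pow_le_one₀ ha0 ha1))
  let y : (Fin d → ℝ) → (Fin d → ℝ) → Fin d → ℝ := fun p q => segPoint (1 / 2) p q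
  have hy : Measurable fun z : (Fin d → ℝ) × (Fin d → ℝ) => y z.1 z.2 := by
    simp only [y]
    unfold segPoint
    fun_prop
  let B : Fin n → Fin n → Set (Sample n d) := fun u j =>
    {ω | u ≠ j ∧ ∀ w, w ≠ u → w ≠ j → ω.1 w ∈ cubeBox a (y (ω.1 u) (ω.1 j)) →
      ¬ ∀ e ∈ ({s(u, w), s(j, w)} : Finset (Sym2 (Fin n))), ω.2 e ≤ α}
  have hB : ∀ u j, law n d (B u j) ≤ ENNReal.ofReal ((1 - α ^ 2 * a ^ d) ^ (n - 2)) := by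
    intro u j
    rcases eq_or_ne u j with h | h
    · simp [B, h]
    · refine (measure_mono fun ω hω => hω.2).trans (law_no_witness_le hα0 hα1 ha0 ha1 h y hy
        (fun w => {s(u, w), s(j, w)}) (fun w _ hwj => Finset.card_pair (by simp [h, hwj])) ?_)
      rintro w ⟨hwu, hwj⟩ w' ⟨hwu', hwj'⟩ hww'
      simp only [Function.onFun, Finset.disjoint_insert_left, Finset.disjoint_singleton_left,
        Finset.mem_insert, Finset.mem_singleton, Sym2.eq_iff]
      grind
  have hsub : {ω : Sample n d | ¬ CommonNeighbor α a ω} ⊆ ⋃ u, ⋃ j, B u j := by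
    intro ω hω
    simp only [CommonNeighbor, Set.mem_ofPred_eq, not_forall] at hω
    obtain ⟨u, j, huj, hω⟩ := hω
    simp only [Set.mem_iUnion]
    exact ⟨u, j, huj, fun w hwu hwj hw he =>
      hω ⟨w, hwu, hwj, hw, he _ (by simp), he _ (by simp)⟩⟩
  calc law n d {ω | ¬ CommonNeighbor α a ω} ≤ law n d (⋃ u, ⋃ j, B u j) := measure_mono hsub
    _ ≤ ∑ u, law n d (⋃ j, B u j) := measure_iUnion_fintype_le _ _
    _ ≤ ∑ u : Fin n, ∑ j, law n d (B u j) :=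
        Finset.sum_le_sum fun u _ => measure_iUnion_fintype_le _ _
    _ ≤ ∑ _u : Fin n, ∑ _j : Fin n, ENNReal.ofReal ((1 - α ^ 2 * a ^ d) ^ (n - 2)) :=
        Finset.sum_le_sum fun u _ => Finset.sum_le_sum fun j _ => hB u j
    _ = ENNReal.ofReal (n ^ 2 * (1 - α ^ 2 * a ^ d) ^ (n - 2)) := by
        rw [ENNReal.ofReal_mul (by positivity), ENNReal.ofReal_pow (by positivity)]
        simp [sq, mul_assoc]

theorem sq_mul_one_sub_pow_le {n : ℕ} (hn : 2 ≤ n) {x : ℝ} (hx : x ≤ 1)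
    (h : 3 * Real.log n ≤ x * ((n : ℝ) - 2)) : (n : ℝ) ^ 2 * (1 - x) ^ (n - 2) ≤ 1 / n := by
  have hn' : (0 : ℝ) < n := by exact_mod_cast (by omega : 0 < n)
  have h1 : (1 - x) ^ (n - 2) ≤ Real.exp (-(3 * Real.log n)) := by
    refine (pow_le_pow_left₀ (by linarith) (Real.one_sub_le_exp_neg x) _).trans ?_
    rw [← Real.exp_nat_mul, Real.exp_le_exp, Nat.cast_sub hn]
    push_cast
    linarith
  have h2 : Real.exp (-(3 * Real.log n)) = 1 / (n : ℝ) ^ 3 := by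
    have : 3 * Real.log n = Real.log ((n : ℝ) ^ 3) := by rw [Real.log_pow]; norm_num
    rw [this, Real.exp_neg, Real.exp_log (by positivity), one_div]
  calc (n : ℝ) ^ 2 * (1 - x) ^ (n - 2) ≤ (n : ℝ) ^ 2 * (1 / (n : ℝ) ^ 3) :=
        mul_le_mul_of_nonneg_left (h1.trans_eq h2) (by positivity)
    _ = 1 / n := by field_simp

theorem law_not_isotropic_le {n d : ℕ} (hn : n ≠ 0) (hd : d ≤ 3) :
    law n d {ω | ¬ ((∀ k, |∑ i, (ω.1 i k - 1 / 2)| ≤ n * (1 / 200)) ∧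
      ∀ k l, |∑ i, ((ω.1 i k - 1 / 2) * (ω.1 i l - 1 / 2) - if k = l then 1 / 12 else 0)| ≤
        n * (1 / 200))} ≤ ENNReal.ofReal (480000 / n) := by
  let B : Fin d → Set (Sample n d) := fun k => {ω | ¬ |∑ i, (ω.1 i k - 1 / 2)| ≤ n * (1 / 200)}
  let C : Fin d → Fin d → Set (Sample n d) := fun k l =>
    {ω | ¬ |∑ i, ((ω.1 i k - 1 / 2) * (ω.1 i l - 1 / 2) - if k = l then 1 / 12 else 0)| ≤
        n * (1 / 200)}
  have hB (k) : law n d (B k) ≤ ENNReal.ofReal (40000 / n) := by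
    refine law_deviation_le hn (fun v => v k - 1 / 2) (by fun_prop) (fun v hv => ?_)
      (integral_pi_unif01_sub_half k)
    obtain ⟨h1, h2⟩ := hv k
    constructor <;> linarith
  have hC (k l) : law n d (C k l) ≤ ENNReal.ofReal (40000 / n) := by
    have hbd (v : Fin d → ℝ) (hv : ∀ k, v k ∈ Set.Icc (0 : ℝ) 1) :
        |(v k - 1 / 2) * (v l - 1 / 2)| ≤ 1 / 4 := by
      have hk (k : Fin d) : |v k - 1 / 2| ≤ 1 / 2 := by
        obtain ⟨h1, h2⟩ := hv k
        rw [abs_le]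
        constructor <;> linarith
      rw [abs_mul]
      exact (mul_le_mul (hk k) (hk l) (abs_nonneg _) (by norm_num)).trans (by norm_num)
    refine law_deviation_le hn (fun v => (v k - 1 / 2) * (v l - 1 / 2) -
      if k = l then 1 / 12 else 0) (by fun_prop) (fun v hv => ?_) ?_
    · have := abs_le.1 (hbd v hv)
      split_ifs <;> constructor <;> linarith
    · rw [integral_sub _ (integrable_const _), integral_pi_unif01_cov]
      · simp
      · refine Integrable.of_bound (by fun_prop) (1 / 4) ?_
        filter_upwards [ae_pi_unif01_mem d] with v hv using hbd v hv
  have hsub : {ω : Sample n d | ¬ ((∀ k, |∑ i, (ω.1 i k - 1 / 2)| ≤ n * (1 / 200)) ∧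
      ∀ k l, |∑ i, ((ω.1 i k - 1 / 2) * (ω.1 i l - 1 / 2) - if k = l then 1 / 12 else 0)| ≤
        n * (1 / 200))} ⊆ (⋃ k, B k) ∪ ⋃ k, ⋃ l, C k l := by
    intro ω hω
    simp only [Set.mem_ofPred_eq, not_and_or, not_forall] at hω
    simp only [Set.mem_union, Set.mem_iUnion]
    exact hω
  have hd' : (d : ENNReal) ≤ 3 := by exact_mod_cast hd
  calc _ ≤ law n d ((⋃ k, B k) ∪ ⋃ k, ⋃ l, C k l) := measure_mono hsub
    _ ≤ law n d (⋃ k, B k) + law n d (⋃ k, ⋃ l, C k l) := measure_union_le _ _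
    _ ≤ ∑ k, law n d (B k) + ∑ k, ∑ l, law n d (C k l) :=
        add_le_add (measure_iUnion_fintype_le _ _) ((measure_iUnion_fintype_le _ _).trans
          (Finset.sum_le_sum fun k _ => measure_iUnion_fintype_le _ _))
    _ ≤ ∑ _k : Fin d, ENNReal.ofReal (40000 / n) +
          ∑ _k : Fin d, ∑ _l : Fin d, ENNReal.ofReal (40000 / n) :=
        add_le_add (Finset.sum_le_sum fun k _ => hB k)
          (Finset.sum_le_sum fun k _ => Finset.sum_le_sum fun l _ => hC k l)
    _ = d * ENNReal.ofReal (40000 / n) + d * (d * ENNReal.ofReal (40000 / n)) := by simp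
    _ ≤ 3 * ENNReal.ofReal (40000 / n) + 3 * (3 * ENNReal.ofReal (40000 / n)) := by gcongr
    _ = 12 * ENNReal.ofReal (40000 / n) := by ring
    _ = ENNReal.ofReal (480000 / n) := by
        rw [show (480000 / n : ℝ) = 12 * (40000 / n) by ring, ENNReal.ofReal_mul (by norm_num)]
        norm_num

theorem rpow_one_div_pow {x : ℝ} (hx : 0 ≤ x) {d : ℕ} (hd : d ≠ 0) :
    (x ^ (1 / (d : ℝ))) ^ d = x := by
  rw [one_div, Real.rpow_inv_natCast_pow hx hd]

theorem exists_forall_log_le {α : ℝ} (hα0 : 0 < α) :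
    ∃ N : ℕ, ∀ n : ℕ, N ≤ n → 3 ≤ n → 12 * Real.log n ≤ α ^ 2 * ((n : ℝ) - 2) := by
  have h := (Real.isLittleO_log_id_atTop.comp_tendsto tendsto_natCast_atTop_atTop).bound
    (c := α ^ 2 / 36) (by positivity)
  obtain ⟨N, hN⟩ := Filter.eventually_atTop.1 h
  refine ⟨N, fun n hn hn3 => ?_⟩
  have h1 := hN n hn
  have hn3' : (3 : ℝ) ≤ n := by exact_mod_cast hn3
  simp only [Function.comp_apply, id, Real.norm_eq_abs] at h1
  rw [abs_of_nonneg (by linarith : (0 : ℝ) ≤ n)] at h1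
  have h2 := (le_abs_self _).trans h1
  have h3 : α ^ 2 * n ≤ α ^ 2 * (3 * ((n : ℝ) - 2)) :=
    mul_le_mul_of_nonneg_left (by linarith) (sq_nonneg α)
  linarith

end Probability

end MDSMap

end

theorem mainTheorem2 (d : ℕ) (hd : d = 2 ∨ d = 3) (α : ℝ) (hα0 : 0 < α) (hα1 : α ≤ 1)
    (ε : ℝ) (hε : 0 < ε) :
    ∃ N : ℕ, ∀ n : ℕ, N ≤ n → ∀ β R : ℝ, 0 ≤ β → β < d → 0 < R →
      (1 / α) ^ (1 / (d : ℝ)) * MDSMap.RMDS d n α < R →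
      1 - ε ≤ (MDSMap.law n d).real {ω : MDSMap.Sample n d |
        (MDSMap.graph α β R ω).Connected ∧
        ∀ Xhat : Matrix (Fin n) (Fin d) ℝ,
          MDSMap.IsMDSMapOutput R (MDSMap.graph α β R ω) Xhat →
          ∃ S : Matrix (Fin d) (Fin d) ℝ,
            1 / Real.sqrt n * MDSMap.frobNorm (MDSMap.centering n * MDSMap.posMatrix ω
                - MDSMap.centering n * Xhat * S)
              ≤ Real.sqrt 6 * (MDSMap.RMDS d n α / R + 20 * R)} := by
  obtain ⟨N, hN⟩ := MDSMap.exists_forall_log_le hα0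
  have hd0 : d ≠ 0 := by omega
  have hd3 : d ≤ 3 := by omega
  refine ⟨max (max N 3) ⌈480002 / ε⌉₊, fun n hn β R hβ _ hR hRM => ?_⟩
  have hn3 : 3 ≤ n := (le_max_right _ _).trans ((le_max_left _ _).trans hn)
  have hlog := hN n ((le_max_left _ _).trans ((le_max_left _ _).trans hn)) hn3
  have hnε : 480002 / (n : ℝ) ≤ ε := by
    have h1 : 480002 / ε ≤ n := Nat.ceil_le.1 ((le_max_right _ _).trans hn)
    have hn' : (0 : ℝ) < n := by exact_mod_cast (by omega : 0 < n)
    rw [div_le_iff₀ hε] at h1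
    rw [div_le_iff₀ hn']
    linarith
  have hn3' : (3 : ℝ) ≤ n := by exact_mod_cast hn3
  have hn2 : (0 : ℝ) < (n : ℝ) - 2 := by linarith
  have hl0 : 0 ≤ Real.log n := Real.log_natCast_nonneg n
  set x := 12 * Real.log n / (α * ((n : ℝ) - 2)) with hx
  have hx0 : 0 ≤ x := by positivity
  set s := x ^ (1 / (d : ℝ)) with hs
  have hs0 : 0 ≤ s := Real.rpow_nonneg hx0 _
  set a := (1 / α * x) ^ (1 / (d : ℝ)) with ha
  have ha0 : 0 ≤ a := Real.rpow_nonneg (by positivity) _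
  have hsa : s ≤ a := Real.rpow_le_rpow hx0
    (le_mul_of_one_le_left hx0 ((one_le_div hα0).2 hα1)) (by positivity)
  have ha1 : a ≤ 1 := by
    refine Real.rpow_le_one (by positivity) ?_ (by positivity)
    rw [hx, div_mul_div_comm, div_le_one (by positivity)]
    linarith
  have hRM' : MDSMap.RMDS d n α = 32 * s := rfl
  have haR : 32 * a ≤ R := by
    rw [hRM'] at hRM
    rw [ha, Real.mul_rpow (by positivity) hx0]
    linarith
  have hsd : s ^ d = x := MDSMap.rpow_one_div_pow hx0 hd0
  have had : a ^ d = 1 / α * x := MDSMap.rpow_one_div_pow (by positivity) hd0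
  have hg : MDSMap.law n d {ω | ¬ MDSMap.GreedyStep α (2 / 3 * s) (R - 1.155 * s) ω} ≤
      ENNReal.ofReal (1 / n) := by
    have hs1 : 2 / 3 * s ≤ 1 := by linarith
    refine (MDSMap.law_not_greedyStep_le hα0.le hα1 (by positivity) hs1).trans
      (ENNReal.ofReal_le_ofReal (MDSMap.sq_mul_one_sub_pow_le (by omega) ?_ ?_))
    · exact mul_le_one₀ (pow_le_one₀ hα0.le hα1) (by positivity) (pow_le_one₀ (by positivity) hs1)
    · have e : α ^ 1 * (2 / 3 * s) ^ d * ((n : ℝ) - 2) = (2 / 3) ^ d * (12 * Real.log n) := by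
        rw [mul_pow, hsd, hx]
        field_simp
      have h23 : (8 / 27 : ℝ) ≤ (2 / 3) ^ d := by
        rcases hd with rfl | rfl <;> norm_num
      rw [e]
      nlinarith
  have hc : MDSMap.law n d {ω | ¬ MDSMap.CommonNeighbor α a ω} ≤ ENNReal.ofReal (1 / n) := by
    refine (MDSMap.law_not_commonNeighbor_le hα0.le hα1 ha0 ha1).trans
      (ENNReal.ofReal_le_ofReal (MDSMap.sq_mul_one_sub_pow_le (by omega) ?_ ?_))
    · exact mul_le_one₀ (pow_le_one₀ hα0.le hα1) (by positivity) (pow_le_one₀ ha0 ha1)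
    · have e : α ^ 2 * a ^ d * ((n : ℝ) - 2) = 12 * Real.log n := by
        rw [had, hx]
        field_simp
      rw [e]
      linarith
  have hi := MDSMap.law_not_isotropic_le (n := n) (by omega) hd3
  have hm : MDSMap.law n d {ω | ¬ ∀ i k, ω.1 i k ∈ Set.Icc (0 : ℝ) 1} = 0 :=
    MDSMap.ae_law_mem n d
  set G := {ω : MDSMap.Sample n d |
        (MDSMap.graph α β R ω).Connected ∧
        ∀ Xhat : Matrix (Fin n) (Fin d) ℝ,
          MDSMap.IsMDSMapOutput R (MDSMap.graph α β R ω) Xhat →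
          ∃ S : Matrix (Fin d) (Fin d) ℝ,
            1 / Real.sqrt n * MDSMap.frobNorm (MDSMap.centering n * MDSMap.posMatrix ω
                - MDSMap.centering n * Xhat * S)
              ≤ Real.sqrt 6 * (MDSMap.RMDS d n α / R + 20 * R)} with hG
  have hbad : MDSMap.law n d Gᶜ ≤ ENNReal.ofReal ε := by
    have hsub : Gᶜ ⊆ {ω | ¬ ∀ i k, ω.1 i k ∈ Set.Icc (0 : ℝ) 1} ∪
        ({ω | ¬ MDSMap.GreedyStep α (2 / 3 * s) (R - 1.155 * s) ω} ∪
        ({ω | ¬ MDSMap.CommonNeighbor α a ω} ∪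
        {ω | ¬ ((∀ k, |∑ i, (ω.1 i k - 1 / 2)| ≤ n * (1 / 200)) ∧
          ∀ k l, |∑ i, ((ω.1 i k - 1 / 2) * (ω.1 i l - 1 / 2) - if k = l then 1 / 12 else 0)| ≤
            n * (1 / 200))})) := by
      intro ω hω
      by_contra h
      simp only [Set.mem_union, Set.mem_ofPred_eq, not_or, not_not] at h
      obtain ⟨h1, h2, h3, h4, h5⟩ := h
      exact hω (MDSMap.connected_and_frobNorm_le (by omega) (by omega) hd3 hα0 hα1 hβ hR ω h1 ha0
        haR hs0 (by linarith) h2 h3 h4 h5)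
    refine (MeasureTheory.measure_mono hsub).trans ((MeasureTheory.measure_union_le _ _).trans ?_)
    rw [hm, zero_add]
    refine (MeasureTheory.measure_union_le _ _).trans ((add_le_add hg
      ((MeasureTheory.measure_union_le _ _).trans (add_le_add hc hi))).trans ?_)
    rw [← ENNReal.ofReal_add (by positivity) (by positivity),
      ← ENNReal.ofReal_add (by positivity) (by positivity)]
    refine ENNReal.ofReal_le_ofReal (le_trans (le_of_eq ?_) hnε)
    ring
  have h1 : (1 : ENNReal) ≤ MDSMap.law n d G + ENNReal.ofReal ε := by
    have := MeasureTheory.measure_univ_le_add_compl (μ := MDSMap.law n d) G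
    rw [MeasureTheory.measure_univ] at this
    exact this.trans (add_le_add le_rfl hbad)
  have h2 : (1 : ENNReal) ≤ ENNReal.ofReal ((MDSMap.law n d).real G + ε) := by
    rwa [ENNReal.ofReal_add MeasureTheory.measureReal_nonneg hε.le,
      MeasureTheory.ofReal_measureReal]
  rw [ENNReal.one_le_ofReal] at h2
  linarith
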